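/- Let $M$ be a complex manifold with complex structure $J$, let $h$ be a smooth Hermitian metric on $M$, and let $g=\operatorname{Re} h$ be its background Riemannian metric. Let $\nabla$ be the Levi-Civita connection of $g$, with curvature $R(X,Y)Z=\nabla_X\nabla_Y Z-\nabla_Y\nabla_X Z-\nabla_{[X,Y]}Z$, and let $D$ be the metric connection on the real tangent bundle $TM$ induced, under the isomorphism $TM\cong T^{1,0}M$, $u\mapsto\frac12(u-\sqrt{-1}\,Ju)$, by the Chern connection of $h$ (the unique connection on $T^{1,0}M$ that is compatible with $h$ and with the holomorphic structure); let $D^2$ be its curvature, $(D^2w)(X,Y)=D_XD_Yw-D_YD_Xw-D_{[X,Y]}w$. For linearly independent $u,v\in T_pM$ define the Riemannian and the Chern sectional curvature by $$K(u,v)=\frac{g(R(u,v)v,u)}{g(u,u)g(v,v)-g(u,v)^2},\qquad K_D(u,v)=\frac{g((D^2u)(v,u),v)}{g(u,u)g(v,v)-g(u,v)^2}.$$ If $K(u,v)=K_D(u,v)$ for every $p\in M$ and all linearly independent $u,v\in T_pM$, then $h$ is a Kähler metric, that is, its fundamental form $\omega(\cdot,\cdot)=g(J\cdot,\cdot)$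 is closed. -/

import Mathlib

open Bundle ComplexConjugate
open scoped Manifold ContDiff

set_option linter.unusedSimpArgs false
set_option linter.unusedSectionVars false

noncomputable section

namespace HermitianGeometry

section Definitions

variable {E : Type*} [NormedAddCommGroup E] [NormedSpace ℂ E]
  {M : Type*} [TopologicalSpace M] [ChartedSpace E M]

/-- A complex manifold modelled on `E` (a manifold with holomorphic coordinate changes) is in
particular a real analytic, hence smooth, manifold modelled on `E` seen as a real vector space. -/
instance instIsManifoldReal [IsManifold 𝓘(ℂ, E) ω M] : IsManifold 𝓘(ℝ, E) ω M := by
  apply isManifold_of_contDiffOn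
  intro e e' he he'
  have h := (contDiffGroupoid ω 𝓘(ℂ, E)).compatible he he'
  rw [contDiffGroupoid, mem_groupoid_of_pregroupoid] at h
  exact h.1.restrict_scalars ℝ

/-- The complex structure `J` on the real tangent space `T_pM`: multiplication by `√-1` in the
holomorphic chart at `p`, through which Mathlib identifies `T_pM` with `E`. As coordinate changes
are holomorphic, it is multiplication by `√-1` in every holomorphic chart (see `coord_J`). -/
def J (p : M) : TangentSpace 𝓘(ℝ, E) p →L[ℝ] TangentSpace 𝓘(ℝ, E) p :=
  (Complex.I • ContinuousLinearMap.id ℝ E : E →L[ℝ] E)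

variable (E M) in
/-- Real vector fields on `M` (sections of the real tangent bundle, with no regularity). -/
abbrev VField : Type _ := Π p : M, TangentSpace 𝓘(ℝ, E) p

variable [IsManifold 𝓘(ℂ, E) ω M]

/-- The vector field `σ` is (real) differentiable at `p`. -/
def IsDifferentiableAt (σ : VField E M) (p : M) : Prop :=
  MDifferentiableAt 𝓘(ℝ, E) (𝓘(ℝ, E).prod 𝓘(ℝ, E))
    (fun q ↦ TotalSpace.mk' E (E := (TangentSpace 𝓘(ℝ, E) : M → Type _)) q (σ q)) p

/-- The vector field `σ` is complex differentiable at `p`, as a section of the holomorphic tangent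
bundle `(TM, J) ≅ T^{1,0}M`, `u ↦ (u - √-1 Ju) / 2`. In other words `σ` is differentiable at `p`
and `∂̄σ = 0` at `p`. -/
def IsHolomorphicAt (σ : VField E M) (p : M) : Prop :=
  MDifferentiableAt 𝓘(ℂ, E) (𝓘(ℂ, E).prod 𝓘(ℂ, E))
    (fun q ↦ TotalSpace.mk' E (E := (TangentSpace 𝓘(ℂ, E) : M → Type _)) q (σ q)) p

variable (E M) in
/-- A (smooth) Hermitian metric `h` on the complex manifold `M`: a Hermitian inner product on each
`(T_pM, J) ≅ T^{1,0}_pM`, complex linear in the first variable and conjugate linear in the second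
one, which depends smoothly, in the real sense, on `p`. -/
structure HermitianMetric where
  /-- the Hermitian inner product on `T_pM` -/
  inner (p : M) : TangentSpace 𝓘(ℝ, E) p →L[ℝ] TangentSpace 𝓘(ℝ, E) p →L[ℝ] ℂ
  J_left (p : M) (u v : TangentSpace 𝓘(ℝ, E) p) : inner p (J p u) v = Complex.I * inner p u v
  conj_symm (p : M) (u v : TangentSpace 𝓘(ℝ, E) p) : conj (inner p v u) = inner p u v
  pos (p : M) (u : TangentSpace 𝓘(ℝ, E) p) (hu : u ≠ 0) : 0 < (inner p u u).re
  contMDiff : ContMDiff 𝓘(ℝ, E) (𝓘(ℝ, E).prod 𝓘(ℝ, E →L[ℝ] E →L[ℝ] ℂ)) ∞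
    (fun p ↦ TotalSpace.mk' (E →L[ℝ] E →L[ℝ] ℂ) p (inner p))

variable (E M) in
/-- Connections (covariant derivatives) on the real tangent bundle of `M`; `D Y p (X p)` is
`(D_X Y)(p)`. -/
abbrev AffineConnection : Type _ :=
  CovariantDerivative 𝓘(ℝ, E) E (TangentSpace 𝓘(ℝ, E) : M → Type _)

/-- The background Riemannian metric `g = Re h`. -/
def HermitianMetric.metric (h : HermitianMetric E M) (p : M) (u v : TangentSpace 𝓘(ℝ, E) p) : ℝ :=
  (h.inner p u v).re

variable [FiniteDimensional ℂ E]

/-- `D` is the Levi-Civita connection of `g = Re h`: it is torsion free and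
`X g(σ, τ) = g(D_X σ, τ) + g(σ, D_X τ)`. -/
structure IsLeviCivita (h : HermitianMetric E M) (D : AffineConnection E M) : Prop where
  torsion_eq_zero : D.torsion = 0
  metric {X σ τ : VField E M} {p : M} (hσ : IsDifferentiableAt σ p) (hτ : IsDifferentiableAt τ p) :
    mvfderiv 𝓘(ℝ, E) (fun q ↦ h.metric q (σ q) (τ q)) p (X p) =
      h.metric p (D σ p (X p)) (τ p) + h.metric p (σ p) (D τ p (X p))

/-- `D` is (the connection on the real tangent bundle that corresponds under `TM ≅ T^{1,0}M` to)
the Chern connection of `h`: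
* it is a complex connection, `D_X (Jσ) = J D_X σ`;
* it is compatible with the Hermitian metric, `X h(σ, τ) = h(D_X σ, τ) + h(σ, D_X τ)`;
* it is compatible with the holomorphic structure, `D^{0,1} = ∂̄`: one has `D^{0,1} σ = 0`, i.e.
  `D_{JX} σ = J D_X σ`, wherever `∂̄σ = 0`. -/
structure IsChern (h : HermitianMetric E M) (D : AffineConnection E M) : Prop where
  complex {X σ : VField E M} {p : M} (hσ : IsDifferentiableAt σ p) :
    D (fun q ↦ J q (σ q)) p (X p) = J p (D σ p (X p))
  metric {X σ τ : VField E M} {p : M} (hσ : IsDifferentiableAt σ p) (hτ : IsDifferentiableAt τ p) :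
    mvfderiv 𝓘(ℝ, E) (fun q ↦ h.inner q (σ q) (τ q)) p (X p) =
      h.inner p (D σ p (X p)) (τ p) + h.inner p (σ p) (D τ p (X p))
  holomorphic {X σ : VField E M} {p : M} (hσ : IsHolomorphicAt σ p) :
    D σ p (J p (X p)) = J p (D σ p (X p))

end Definitions

section Aux
variable {E : Type*} [NormedAddCommGroup E] [NormedSpace ℂ E]
  {M : Type*} [TopologicalSpace M] [ChartedSpace E M] [IsManifold 𝓘(ℂ, E) ω M]

theorem IsDifferentiableAt.inner (h : HermitianMetric E M) {σ τ : VField E M} {p : M}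
    (hσ : IsDifferentiableAt σ p) (hτ : IsDifferentiableAt τ p) :
    MDifferentiableAt 𝓘(ℝ, E) 𝓘(ℝ, ℂ) (fun q ↦ h.inner q (σ q) (τ q)) p := by
  have : MDifferentiableAt 𝓘(ℝ, E) (𝓘(ℝ, E).prod 𝓘(ℝ, ℂ))
      (fun m ↦ TotalSpace.mk' ℂ (E := Bundle.Trivial M ℂ) m (h.inner m (σ m) (τ m))) p := by
    apply MDifferentiableAt.clm_bundle_apply₂ (F₁ := E) (F₂ := E)
    · exact h.contMDiff.mdifferentiable (by simp) p
    · exact hσ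
    · exact hτ
  simp only [mdifferentiableAt_totalSpace] at this
  exact this.2

/-- The vector field `σ` written in the holomorphic chart at `p`. -/
def coord (p : M) (σ : VField E M) (q : M) : E :=
  (trivializationAt E (TangentSpace 𝓘(ℝ, E) : M → Type _) p ⟨q, σ q⟩).2

theorem isDifferentiableAt_iff (σ : VField E M) (p : M) :
    IsDifferentiableAt σ p ↔ MDifferentiableAt 𝓘(ℝ, E) 𝓘(ℝ, E) (coord p σ) p :=
  mdifferentiableAt_section _ _

theorem coord_add (p : M) (σ τ : VField E M) (q : M) :
    coord p (σ + τ) q = coord p σ q + coord p τ q := by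
  simp [coord, TangentBundle.trivializationAt_apply]
  exact ContinuousLinearMap.map_add _ _ _

theorem coord_smul (p : M) (f : M → ℝ) (σ : VField E M) (q : M)  :
    coord p (f • σ) q = f q • coord p σ q := by
  simp [coord, TangentBundle.trivializationAt_apply]
  exact ContinuousLinearMap.map_smul _ _ _

theorem differentiableAt_transition (p q : M) (hq : q ∈ (chartAt E p).source) :
    DifferentiableAt ℂ (chartAt E p ∘ (chartAt E q).symm) (chartAt E q q) := by
  have h := (contDiffGroupoid ω 𝓘(ℂ, E)).compatible
    (chart_mem_atlas E q) (chart_mem_atlas E p)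
  rw [contDiffGroupoid, mem_groupoid_of_pregroupoid] at h
  have h1 := h.1
  simp only [contDiffPregroupoid] at h1
  have h2 : ContDiffOn ℂ ω (chartAt E p ∘ (chartAt E q).symm)
    ((chartAt E q).symm.trans (chartAt E p)).source := by simpa using h1
  refine (h2.contDiffAt (IsOpen.mem_nhds (OpenPartialHomeomorph.open_source _) ?_)).differentiableAt (by simp)
  simp [hq]

theorem coord_eq (p : M) (σ : VField E M) (q : M) (hq : q ∈ (chartAt E p).source) :
    coord p σ q = fderiv ℂ (chartAt E p ∘ (chartAt E q).symm) (chartAt E q q) (σ q) := by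
  have := (differentiableAt_transition p q hq).fderiv_restrictScalars ℝ
  simp [coord, TangentBundle.trivializationAt_apply, this]

theorem coord_eq_complex (p : M) (σ : VField E M) (q : M) (hq : q ∈ (chartAt E p).source) :
    coord p σ q =
      (trivializationAt E (TangentSpace 𝓘(ℂ, E) : M → Type _) p ⟨q, σ q⟩).2 := by
  rw [coord_eq _ _ _ hq]
  simp [TangentBundle.trivializationAt_apply]

theorem coord_J (p : M) (σ : VField E M) (q : M) (hq : q ∈ (chartAt E p).source) :
    coord p (fun x ↦ J x (σ x)) q = Complex.I • coord p σ q := by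
  rw [coord_eq _ _ _ hq, coord_eq _ _ _ hq]
  exact ContinuousLinearMap.map_smul _ _ _

theorem coord_self (p : M) (σ : VField E M) : coord p σ p = σ p := by
  rw [coord_eq _ _ _ (mem_chart_source E p)]
  have : (chartAt E p ∘ (chartAt E p).symm) =ᶠ[nhds (chartAt E p p)] id := by
    filter_upwards [(chartAt E p).open_target.mem_nhds (mem_chart_target E p)] with y hy
    exact (chartAt E p).right_inv hy
  rw [this.fderiv_eq, fderiv_id]
  rfl

theorem J_J (p : M) (v : TangentSpace 𝓘(ℝ, E) p) : J p (J p v) = -v := by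
  have h (w : E) : Complex.I • Complex.I • w = -w := by
    rw [smul_smul, Complex.I_mul_I, neg_one_smul]
  exact h v

theorem IsDifferentiableAt.J {σ : VField E M} {p : M} (hσ : IsDifferentiableAt σ p) :
    IsDifferentiableAt (fun q ↦ HermitianGeometry.J q (σ q)) p := by
  rw [isDifferentiableAt_iff] at *
  have h1 : MDifferentiableAt 𝓘(ℝ, E) 𝓘(ℝ, E) (fun q ↦ Complex.I • coord p σ q) p :=
    ((Complex.I • ContinuousLinearMap.id ℝ E : E →L[ℝ] E).mdifferentiableAt
      (x := coord p σ p)).comp p hσ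
  refine h1.congr_of_eventuallyEq ?_
  filter_upwards [(chartAt E p).open_source.mem_nhds (mem_chart_source E p)] with q hq
  exact coord_J p σ q hq

variable (E M) in
/-- The connection whose value at `p` is the flat connection of the chart at `p` (an auxiliary
connection, to which suitable tensors are added below). -/
def flat : AffineConnection E M where
  toFun σ p := (mvfderiv 𝓘(ℝ, E) (coord p σ) p : TangentSpace 𝓘(ℝ, E) p →L[ℝ] E)
  isCovariantDerivativeOnUniv :=
    { add := by
        intro σ τ p hσ hτ _
        have : coord p (σ + τ) = coord p σ + coord p τ := funext fun q ↦ coord_add p σ τ q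
        rw [this]
        exact mvfderiv_add ((isDifferentiableAt_iff _ _).1 hσ) ((isDifferentiableAt_iff _ _).1 hτ)
      leibniz := by
        intro σ g p hσ hg _
        have : coord p (g • σ) = g • coord p σ := funext fun q ↦ coord_smul p g σ q
        rw [this]
        refine (mvfderiv_smul hg ((isDifferentiableAt_iff _ _).1 hσ)).trans ?_
        rw [coord_self]
        rfl }

theorem flat_J {σ : VField E M} {p : M} (hσ : IsDifferentiableAt σ p)
    (v : TangentSpace 𝓘(ℝ, E) p) :
    flat E M (fun q ↦ J q (σ q)) p v = J p (flat E M σ p v) := by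
  rw [isDifferentiableAt_iff] at hσ
  have h1 : coord p (fun q ↦ J q (σ q)) =ᶠ[nhds p] fun q ↦ Complex.I • coord p σ q := by
    filter_upwards [(chartAt E p).open_source.mem_nhds (mem_chart_source E p)] with q hq
    exact coord_J p σ q hq
  have h2 := (Complex.I • ContinuousLinearMap.id ℝ E : E →L[ℝ] E).hasMFDerivAt
      (x := coord p σ p) |>.comp p hσ.hasMFDerivAt
  have h3 := (h2.congr_of_eventuallyEq (f₁ := coord p (fun q ↦ J q (σ q))) h1).mfderiv
  exact congr($h3 v)

theorem IsHolomorphicAt.mdifferentiableAt_coord {σ : VField E M} {p : M}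
    (hσ : IsHolomorphicAt σ p) : MDifferentiableAt 𝓘(ℂ, E) 𝓘(ℂ, E) (coord p σ) p := by
  have h1 : MDifferentiableAt 𝓘(ℂ, E) 𝓘(ℂ, E) (fun q ↦
      (trivializationAt E (TangentSpace 𝓘(ℂ, E) : M → Type _) p ⟨q, σ q⟩).2) p :=
    (mdifferentiableAt_section _ _).1 hσ
  refine h1.congr_of_eventuallyEq ?_
  filter_upwards [(chartAt E p).open_source.mem_nhds (mem_chart_source E p)] with q hq
  exact coord_eq_complex p σ q hq

theorem IsHolomorphicAt.isDifferentiableAt {σ : VField E M} {p : M}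
    (hσ : IsHolomorphicAt σ p) : IsDifferentiableAt σ p := by
  have h2 := hσ.mdifferentiableAt_coord
  have h2' := h2.differentiableWithinAt_writtenInExtChartAt
  rw [isDifferentiableAt_iff, mdifferentiableAt_iff]
  refine ⟨h2.continuousAt, ?_⟩
  simpa using h2'.restrictScalars ℝ

theorem flat_holomorphic {σ : VField E M} {p : M} (hσ : IsHolomorphicAt σ p)
    (v : TangentSpace 𝓘(ℝ, E) p) :
    flat E M σ p (J p v) = J p (flat E M σ p v) := by
  have h2 := hσ.mdifferentiableAt_coord
  have h2' := h2.differentiableWithinAt_writtenInExtChartAt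
  have h3 := (isDifferentiableAt_iff σ p).1 hσ.isDifferentiableAt
  have h4 : ∀ w : E, mvfderiv 𝓘(ℝ, E) (coord p σ) p w = mvfderiv 𝓘(ℂ, E) (coord p σ) p w := by
    intro w
    rw [h3.mvfderiv, h2.mvfderiv]
    simp only [writtenInExtChartAt, modelWithCornersSelf_coe, Set.range_id,
      fderivWithin_univ, mfld_simps] at h2' ⊢
    rw [differentiableWithinAt_univ] at h2'
    rw [h2'.fderiv_restrictScalars ℝ]
    rfl
  exact (h4 _).trans ((ContinuousLinearMap.map_smul _ _ _).trans (congrArg _ (h4 v).symm))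

end Aux

section Metric
variable {E : Type*} [NormedAddCommGroup E] [NormedSpace ℂ E]
  {M : Type*} [TopologicalSpace M] [ChartedSpace E M] [IsManifold 𝓘(ℂ, E) ω M]

/-- `X ↦ X h(σ, τ) - h(D_X σ, τ) - h(σ, D_X τ)`. -/
def nonmetAux (h : HermitianMetric E M) (D : AffineConnection E M) (σ τ : VField E M) (p : M) :
    TangentSpace 𝓘(ℝ, E) p →L[ℝ] ℂ :=
  mvfderiv 𝓘(ℝ, E) (fun q ↦ h.inner q (σ q) (τ q)) p
    - (Complex.conjCLE : ℂ →L[ℝ] ℂ) ∘L h.inner p (τ p) ∘L D σ p - h.inner p (σ p) ∘L D τ p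

theorem nonmetAux_apply (h : HermitianMetric E M) (D : AffineConnection E M) (σ τ : VField E M)
    (p : M) (v : TangentSpace 𝓘(ℝ, E) p) :
    nonmetAux h D σ τ p v = mvfderiv 𝓘(ℝ, E) (fun q ↦ h.inner q (σ q) (τ q)) p v
      - h.inner p (D σ p v) (τ p) - h.inner p (σ p) (D τ p v) := by
  rw [← h.conj_symm p (D σ p v)]
  rfl

theorem nonmetAux_tensorial₁ (h : HermitianMetric E M) (D : AffineConnection E M) (τ : VField E M)
    (p : M) (hτ : IsDifferentiableAt τ p) :
    TensorialAt 𝓘(ℝ, E) E (nonmetAux h D · τ p) p where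
  smul := by
    intro f σ hf hσ
    have h1 : (fun q ↦ h.inner q ((f • σ) q) (τ q)) = f • fun q ↦ h.inner q (σ q) (τ q) := by
      ext q; simp
    ext v
    simp only [nonmetAux_apply, add_apply, smul_apply, smul_eq_mul, Complex.real_smul]
    rw [h1, mvfderiv_smul hf (IsDifferentiableAt.inner h hσ hτ),
      D.isCovariantDerivativeOn.leibniz hσ hf]
    simp
    ring
  add := by
    intro σ σ' hσ hσ'
    have h1 : (fun q ↦ h.inner q ((σ + σ') q) (τ q)) =
      (fun q ↦ h.inner q (σ q) (τ q)) + (fun q ↦ h.inner q (σ' q) (τ q)) := by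
      ext q; simp
    ext v
    simp only [nonmetAux_apply, add_apply, smul_apply, smul_eq_mul, Complex.real_smul]
    rw [h1, mvfderiv_add (IsDifferentiableAt.inner h hσ hτ) (IsDifferentiableAt.inner h hσ' hτ),
      D.isCovariantDerivativeOn.add hσ hσ']
    simp
    ring

theorem nonmetAux_tensorial₂ (h : HermitianMetric E M) (D : AffineConnection E M) (τ : VField E M)
    (p : M) (hτ : IsDifferentiableAt τ p) :
    TensorialAt 𝓘(ℝ, E) E (nonmetAux h D τ · p) p where
  smul := by
    intro f σ hf hσ
    have h1 : (fun q ↦ h.inner q (τ q) ((f • σ) q)) = f • fun q ↦ h.inner q (τ q) (σ q) := by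
      ext q; simp
    ext v
    simp only [nonmetAux_apply, add_apply, smul_apply, smul_eq_mul, Complex.real_smul]
    rw [h1, mvfderiv_smul hf (IsDifferentiableAt.inner h hτ hσ),
      D.isCovariantDerivativeOn.leibniz hσ hf]
    simp
    ring
  add := by
    intro σ σ' hσ hσ'
    have h1 : (fun q ↦ h.inner q (τ q) ((σ + σ') q)) =
      (fun q ↦ h.inner q (τ q) (σ q)) + (fun q ↦ h.inner q (τ q) (σ' q)) := by
      ext q; simp
    ext v
    simp only [nonmetAux_apply, add_apply, smul_apply, smul_eq_mul, Complex.real_smul]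
    rw [h1, mvfderiv_add (IsDifferentiableAt.inner h hτ hσ) (IsDifferentiableAt.inner h hτ hσ'),
      D.isCovariantDerivativeOn.add hσ hσ']
    simp
    ring

end Metric

section Algebra
variable {E : Type*} [NormedAddCommGroup E] [NormedSpace ℝ E] [FiniteDimensional ℝ E]

theorem exists_sharp (g : E → E → ℝ) (g_add : ∀ u v w, g (u + v) w = g u w + g v w)
    (g_smul : ∀ (c : ℝ) u w, g (c • u) w = c * g u w)
    (g_symm : ∀ u v, g u v = g v u) (g_pos : ∀ u, u ≠ 0 → 0 < g u u)
    (B : E → E → E → ℝ)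
    (add₁ : ∀ u u' v w, B (u + u') v w = B u v w + B u' v w)
    (smul₁ : ∀ (c : ℝ) u v w, B (c • u) v w = c * B u v w)
    (add₂ : ∀ u v v' w, B u (v + v') w = B u v w + B u v' w)
    (smul₂ : ∀ (c : ℝ) u v w, B u (c • v) w = c * B u v w)
    (add₃ : ∀ u v w w', B u v (w + w') = B u v w + B u v w')
    (smul₃ : ∀ (c : ℝ) u v w, B u v (c • w) = c * B u v w) :
    ∃ A : E →L[ℝ] E →L[ℝ] E, ∀ u v w, g (A u v) w = B u v w := by
  have inj : ∀ u u', (∀ w, g u w = g u' w) → u = u' := by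
    intro u u' h
    by_contra hne
    have h1 := g_pos (u + (-1 : ℝ) • u') (by
      intro h0; apply hne; rwa [neg_one_smul, ← sub_eq_add_neg, sub_eq_zero] at h0)
    rw [g_add, g_smul, h] at h1
    linarith
  let G : E →ₗ[ℝ] Module.Dual ℝ E := LinearMap.mk₂ ℝ g g_add g_smul
    (fun u v w ↦ by rw [g_symm, g_add, g_symm v, g_symm w])
    (fun c u v ↦ by rw [g_symm, g_smul, g_symm]; rfl)
  have hG : Function.Injective G := fun u u' h ↦ inj u u' fun w ↦ congr($h w)
  have hG' : Function.Surjective G :=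
    (LinearMap.injective_iff_surjective_of_finrank_eq_finrank
      (Subspace.dual_finrank_eq (K := ℝ) (V := E)).symm).1 hG
  have key : ∀ u v, ∃ a, ∀ w, g a w = B u v w := by
    intro u v
    obtain ⟨a, ha⟩ := hG' { toFun := B u v, map_add' := add₃ u v, map_smul' := fun c w ↦ smul₃ c u v w }
    exact ⟨a, fun w ↦ congr($ha w)⟩
  choose a ha using key
  let A : E →ₗ[ℝ] E →ₗ[ℝ] E := LinearMap.mk₂ ℝ a
    (fun u u' v ↦ inj _ _ fun w ↦ by simp only [g_add, ha, add₁])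
    (fun c u v ↦ inj _ _ fun w ↦ by simp only [g_smul, ha, smul₁])
    (fun u v v' ↦ inj _ _ fun w ↦ by simp only [g_add, ha, add₂])
    (fun c u v ↦ inj _ _ fun w ↦ by simp only [g_smul, ha, smul₂])
  exact ⟨A.toContinuousBilinearMap, fun u v w ↦ ha u v w⟩

end Algebra

section Existence
variable {E : Type*} [NormedAddCommGroup E] [NormedSpace ℂ E] [FiniteDimensional ℂ E]
  {M : Type*} [TopologicalSpace M] [ChartedSpace E M] [IsManifold 𝓘(ℂ, E) ω M]

theorem HermitianMetric.metric_symm (h : HermitianMetric E M) (p : M)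
    (u v : TangentSpace 𝓘(ℝ, E) p) : h.metric p u v = h.metric p v u := by
  rw [HermitianMetric.metric, HermitianMetric.metric, ← h.conj_symm p u v, Complex.conj_re]

theorem HermitianMetric.metric_add (h : HermitianMetric E M) (p : M)
    (u v w : TangentSpace 𝓘(ℝ, E) p) : h.metric p (u + v) w = h.metric p u w + h.metric p v w := by
  simp [HermitianMetric.metric]

theorem HermitianMetric.metric_smul (h : HermitianMetric E M) (p : M) (c : ℝ)
    (u w : TangentSpace 𝓘(ℝ, E) p) : h.metric p (c • u) w = c * h.metric p u w := by
  simp [HermitianMetric.metric]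

theorem HermitianMetric.metric_add' (h : HermitianMetric E M) (p : M)
    (u v w : TangentSpace 𝓘(ℝ, E) p) : h.metric p w (u + v) = h.metric p w u + h.metric p w v := by
  simp [HermitianMetric.metric]

theorem HermitianMetric.metric_smul' (h : HermitianMetric E M) (p : M) (c : ℝ)
    (u w : TangentSpace 𝓘(ℝ, E) p) : h.metric p w (c • u) = c * h.metric p w u := by
  simp [HermitianMetric.metric]

theorem HermitianMetric.im_eq (h : HermitianMetric E M) (p : M)
    (u v : TangentSpace 𝓘(ℝ, E) p) : (h.inner p u v).im = -h.metric p (J p u) v := by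
  simp [HermitianMetric.metric, h.J_left]

theorem HermitianMetric.J_right (h : HermitianMetric E M) (p : M)
    (u v : TangentSpace 𝓘(ℝ, E) p) : h.inner p u (J p v) = -Complex.I * h.inner p u v := by
  rw [← h.conj_symm, h.J_left, map_mul, h.conj_symm, Complex.conj_I]

theorem HermitianMetric.exists_endomorphism (h : HermitianMetric E M) (p : M)
    (B : TangentSpace 𝓘(ℝ, E) p → TangentSpace 𝓘(ℝ, E) p → TangentSpace 𝓘(ℝ, E) p → ℝ)
    (add₁ : ∀ u u' v w, B (u + u') v w = B u v w + B u' v w)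
    (smul₁ : ∀ (c : ℝ) u v w, B (c • u) v w = c * B u v w)
    (add₂ : ∀ u v v' w, B u (v + v') w = B u v w + B u v' w)
    (smul₂ : ∀ (c : ℝ) u v w, B u (c • v) w = c * B u v w)
    (add₃ : ∀ u v w w', B u v (w + w') = B u v w + B u v w')
    (smul₃ : ∀ (c : ℝ) u v w, B u v (c • w) = c * B u v w) :
    ∃ A : TangentSpace 𝓘(ℝ, E) p →L[ℝ] TangentSpace 𝓘(ℝ, E) p →L[ℝ] TangentSpace 𝓘(ℝ, E) p,
      ∀ u v w, h.metric p (A u v) w = B u v w :=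
  exists_sharp (E := E) (h.metric p) (h.metric_add p)
    (h.metric_smul p) (h.metric_symm p) (h.pos p) B
    add₁ smul₁ add₂ smul₂ add₃ smul₃

/-- The tensor `(σ, τ, X) ↦ X h(σ, τ) - h(D_X σ, τ) - h(σ, D_X τ)`. -/
def nonmet (h : HermitianMetric E M) (D : AffineConnection E M) (p : M) :
    TangentSpace 𝓘(ℝ, E) p →L[ℝ] TangentSpace 𝓘(ℝ, E) p →L[ℝ] TangentSpace 𝓘(ℝ, E) p →L[ℝ] ℂ :=
  TensorialAt.mkHom₂ (nonmetAux h D · · p) p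
    (fun τ hτ ↦ nonmetAux_tensorial₁ h D τ p hτ) (fun τ hτ ↦ nonmetAux_tensorial₂ h D τ p hτ)

theorem nonmet_apply (h : HermitianMetric E M) (D : AffineConnection E M) {σ τ : VField E M}
    {p : M} (hσ : IsDifferentiableAt σ p) (hτ : IsDifferentiableAt τ p)
    (v : TangentSpace 𝓘(ℝ, E) p) :
    nonmet h D p (σ p) (τ p) v = mvfderiv 𝓘(ℝ, E) (fun q ↦ h.inner q (σ q) (τ q)) p v
      - h.inner p (D σ p v) (τ p) - h.inner p (σ p) (D τ p v) := by
  rw [← nonmetAux_apply, nonmet, TensorialAt.mkHom₂_apply _ _ hσ hτ]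

theorem nonmet_eq_extend (h : HermitianMetric E M) (D : AffineConnection E M) {p : M}
    (u v w : TangentSpace 𝓘(ℝ, E) p) :
    ∃ σ τ : VField E M, IsDifferentiableAt σ p ∧ IsDifferentiableAt τ p ∧ σ p = u ∧ τ p = v ∧
    nonmet h D p u v w = nonmetAux h D σ τ p w :=
  ⟨FiberBundle.extend E u, FiberBundle.extend E v, FiberBundle.mdifferentiableAt_extend ..,
    FiberBundle.mdifferentiableAt_extend .., by simp, by simp, rfl⟩

section linear
variable (h : HermitianMetric E M) (D : AffineConnection E M) (p : M) (c : ℝ)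
  (u v w x : TangentSpace 𝓘(ℝ, E) p)

theorem nonmet_add₁ : nonmet h D p (u + x) v w = nonmet h D p u v w + nonmet h D p x v w :=
  congr($((nonmet h D p).map_add u x) v w)

theorem nonmet_add₂ : nonmet h D p u (v + x) w = nonmet h D p u v w + nonmet h D p u x w :=
  congr($((nonmet h D p u).map_add v x) w)

theorem nonmet_add₃ : nonmet h D p u v (w + x) = nonmet h D p u v w + nonmet h D p u v x :=
  map_add _ _ _

theorem nonmet_smul₁ : nonmet h D p (c • u) v w = c • nonmet h D p u v w :=
  congr($((nonmet h D p).map_smul c u) v w)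

theorem nonmet_smul₂ : nonmet h D p u (c • v) w = c • nonmet h D p u v w :=
  congr($((nonmet h D p u).map_smul c v) w)

theorem nonmet_smul₃ : nonmet h D p u v (c • w) = c • nonmet h D p u v w :=
  map_smul _ _ _

theorem torsion_add₁ : D.torsion p (u + v) w = D.torsion p u w + D.torsion p v w :=
  congr($((D.torsion p).map_add u v) w)

theorem torsion_smul₁ : D.torsion p (c • u) w = c • D.torsion p u w :=
  congr($((D.torsion p).map_smul c u) w)

theorem torsion_add₂ : D.torsion p w (u + v) = D.torsion p w u + D.torsion p w v :=
  map_add _ _ _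

theorem torsion_smul₂ : D.torsion p w (c • u) = c • D.torsion p w u :=
  map_smul _ _ _

end linear

theorem nonmet_conj (h : HermitianMetric E M) (D : AffineConnection E M) (p : M)
    (u v w : TangentSpace 𝓘(ℝ, E) p) :
    conj (nonmet h D p v u w) = nonmet h D p u v w := by
  obtain ⟨σ, τ, hσ, hτ, rfl, rfl, -⟩ := nonmet_eq_extend h D u v w
  have h1 : (fun q ↦ h.inner q (σ q) (τ q)) =
      (Complex.conjCLE : ℂ →L[ℝ] ℂ) ∘ (fun q ↦ h.inner q (τ q) (σ q)) := by
    ext q; exact (h.conj_symm q _ _).symm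
  have h2 := (Complex.conjCLE : ℂ →L[ℝ] ℂ).hasMFDerivAt.comp p (hτ.inner h hσ).hasMFDerivAt
  have h3 : mvfderiv 𝓘(ℝ, E) (fun q ↦ h.inner q (σ q) (τ q)) p w =
    conj (mvfderiv 𝓘(ℝ, E) (fun q ↦ h.inner q (τ q) (σ q)) p w) := by
    rw [h1]
    exact congr($(h2.mfderiv) w)
  rw [nonmet_apply h D hσ hτ, nonmet_apply h D hτ hσ, h3]
  simp only [map_sub, h.conj_symm]
  ring

theorem nonmet_J (h : HermitianMetric E M) (D : AffineConnection E M)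
    (hD : ∀ (σ : VField E M) (p : M) (v : TangentSpace 𝓘(ℝ, E) p), IsDifferentiableAt σ p →
      D (fun q ↦ J q (σ q)) p v = J p (D σ p v)) (p : M)
    (u v w : TangentSpace 𝓘(ℝ, E) p) :
    nonmet h D p (J p u) v w = Complex.I * nonmet h D p u v w := by
  obtain ⟨σ, τ, hσ, hτ, rfl, rfl, -⟩ := nonmet_eq_extend h D u v w
  have h1 : (fun q ↦ h.inner q (J q (σ q)) (τ q)) =
      (Complex.I • ContinuousLinearMap.id ℝ ℂ : ℂ →L[ℝ] ℂ) ∘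
        (fun q ↦ h.inner q (σ q) (τ q)) := by
    ext q; exact h.J_left q _ _
  have h2 := (Complex.I • ContinuousLinearMap.id ℝ ℂ : ℂ →L[ℝ] ℂ).hasMFDerivAt.comp p
    (hσ.inner h hτ).hasMFDerivAt
  have h3 : mvfderiv 𝓘(ℝ, E) (fun q ↦ h.inner q (J q (σ q)) (τ q)) p w =
    Complex.I * (mvfderiv 𝓘(ℝ, E) (fun q ↦ h.inner q (σ q) (τ q)) p w) := by
    rw [h1]
    exact congr($(h2.mfderiv) w)
  rw [nonmet_apply h D hσ.J hτ, nonmet_apply h D hσ hτ, h3, hD _ _ _ hσ, h.J_left, h.J_left]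
  ring

theorem mvfderiv_re (h : HermitianMetric E M) {σ τ : VField E M} {p : M}
    (hσ : IsDifferentiableAt σ p) (hτ : IsDifferentiableAt τ p) (v : TangentSpace 𝓘(ℝ, E) p) :
    mvfderiv 𝓘(ℝ, E) (fun q ↦ h.metric q (σ q) (τ q)) p v =
      (mvfderiv 𝓘(ℝ, E) (fun q ↦ h.inner q (σ q) (τ q)) p v).re :=
  congr($((Complex.reCLM.hasMFDerivAt.comp p (hσ.inner h hτ).hasMFDerivAt).mfderiv) v)

theorem exists_isLeviCivita (h : HermitianMetric E M) :
    ∃ D : AffineConnection E M, IsLeviCivita h D := by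
  let q := fun (p : M) (u v w : TangentSpace 𝓘(ℝ, E) p) ↦ (nonmet h (flat E M) p u v w).re
  let t := fun (p : M) (u v w : TangentSpace 𝓘(ℝ, E) p) ↦ h.metric p ((flat E M).torsion p u v) w
  have q_symm : ∀ p u v w, q p u v w = q p v u w := fun p u v w ↦ by
    simp only [q]; rw [← nonmet_conj, Complex.conj_re]
  have t_symm : ∀ p u v w, t p u v w = -t p v u w := fun p u v w ↦ by
    simp only [t]; rw [CovariantDerivative.torsion_antisymm]; simp [HermitianMetric.metric]
  have key (p : M) := h.exists_endomorphism p
    (fun y x z ↦ (q p y z x + q p x z y - q p x y z - t p x y z + t p x z y + t p y z x) / 2)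
    (fun _ _ _ _ ↦ by
      simp only [q, t, nonmet_add₁, nonmet_add₂, nonmet_add₃, nonmet_smul₁, nonmet_smul₂,
      nonmet_smul₃, Complex.add_re, Complex.smul_re, smul_eq_mul, torsion_add₁, torsion_add₂,
      torsion_smul₁, torsion_smul₂, h.metric_add, h.metric_smul, h.metric_add', h.metric_smul']
      ring)
    (fun _ _ _ _ ↦ by
      simp only [q, t, nonmet_add₁, nonmet_add₂, nonmet_add₃, nonmet_smul₁, nonmet_smul₂,
      nonmet_smul₃, Complex.add_re, Complex.smul_re, smul_eq_mul, torsion_add₁, torsion_add₂,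
      torsion_smul₁, torsion_smul₂, h.metric_add, h.metric_smul, h.metric_add', h.metric_smul']
      ring)
    (fun _ _ _ _ ↦ by
      simp only [q, t, nonmet_add₁, nonmet_add₂, nonmet_add₃, nonmet_smul₁, nonmet_smul₂,
      nonmet_smul₃, Complex.add_re, Complex.smul_re, smul_eq_mul, torsion_add₁, torsion_add₂,
      torsion_smul₁, torsion_smul₂, h.metric_add, h.metric_smul, h.metric_add', h.metric_smul']
      ring)
    (fun _ _ _ _ ↦ by
      simp only [q, t, nonmet_add₁, nonmet_add₂, nonmet_add₃, nonmet_smul₁, nonmet_smul₂,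
      nonmet_smul₃, Complex.add_re, Complex.smul_re, smul_eq_mul, torsion_add₁, torsion_add₂,
      torsion_smul₁, torsion_smul₂, h.metric_add, h.metric_smul, h.metric_add', h.metric_smul']
      ring)
    (fun _ _ _ _ ↦ by
      simp only [q, t, nonmet_add₁, nonmet_add₂, nonmet_add₃, nonmet_smul₁, nonmet_smul₂,
      nonmet_smul₃, Complex.add_re, Complex.smul_re, smul_eq_mul, torsion_add₁, torsion_add₂,
      torsion_smul₁, torsion_smul₂, h.metric_add, h.metric_smul, h.metric_add', h.metric_smul']
      ring)
    (fun _ _ _ _ ↦ by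
      simp only [q, t, nonmet_add₁, nonmet_add₂, nonmet_add₃, nonmet_smul₁, nonmet_smul₂,
      nonmet_smul₃, Complex.add_re, Complex.smul_re, smul_eq_mul, torsion_add₁, torsion_add₂,
      torsion_smul₁, torsion_smul₂, h.metric_add, h.metric_smul, h.metric_add', h.metric_smul']
      ring)
  choose A hA using key
  refine ⟨(flat E M).addOneForm A, ?_, ?_⟩
  · have inj (p : M) (u : TangentSpace 𝓘(ℝ, E) p) (hu : ∀ w, h.metric p u w = 0) : u = 0 := by
      by_contra hne
      exact (h.pos p u hne).ne' (hu u)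
    rw [CovariantDerivative.torsion_eq_zero_iff]
    intro X Y p hX hY
    have h1 := (flat E M).torsion_apply hX hY
    have h2 : (flat E M).torsion p (X p) (Y p) + A p (Y p) (X p) - A p (X p) (Y p) = 0 := by
      apply inj
      intro w
      have h3 := hA p (Y p) (X p) w
      have h4 := hA p (X p) (Y p) w
      have h5 := q_symm p (X p) (Y p) w
      have h6 := t_symm p (X p) (Y p) w
      have h7 := h.metric_add p ((flat E M).torsion p (X p) (Y p) + A p (Y p) (X p) - A p (X p) (Y p))
        (A p (X p) (Y p)) w
      rw [sub_add_cancel, h.metric_add] at h7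
      have h8 : t p (X p) (Y p) w = h.metric p ((flat E M).torsion p (X p) (Y p)) w := rfl
      linarith
    rw [h1] at h2
    have h3 : (flat E M).addOneForm A Y p (X p) = flat E M Y p (X p) + A p (Y p) (X p) := rfl
    have h4 : (flat E M).addOneForm A X p (Y p) = flat E M X p (Y p) + A p (X p) (Y p) := rfl
    change (flat E M).addOneForm A Y p (X p) - (flat E M).addOneForm A X p (Y p) = _
    rw [h3, h4, ← sub_eq_zero, ← h2]
    abel
  · intro X σ τ p hσ hτ
    rw [mvfderiv_re h hσ hτ]
    have h1 := congrArg Complex.re (nonmet_apply h (flat E M) hσ hτ (X p))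
    have h2 := hA p (σ p) (X p) (τ p)
    have h3 := hA p (τ p) (X p) (σ p)
    have h4 : (flat E M).addOneForm A σ p (X p) = flat E M σ p (X p) + A p (σ p) (X p) := rfl
    have h5 : (flat E M).addOneForm A τ p (X p) = flat E M τ p (X p) + A p (τ p) (X p) := rfl
    have h6 := q_symm p (σ p) (τ p) (X p)
    have h7 := t_symm p (X p) (σ p) (τ p)
    have h8 := t_symm p (X p) (τ p) (σ p)
    have h9 := t_symm p (σ p) (τ p) (X p)
    have h10 := q_symm p (X p) (τ p) (σ p)
    have h11 := q_symm p (X p) (σ p) (τ p)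
    have h12 := h.metric_symm p (σ p) (A p (τ p) (X p))
    rw [h4, h5]
    simp only [HermitianMetric.metric, q, map_add, add_apply, Complex.add_re, Complex.sub_re] at *
    linarith

theorem exists_isChern (h : HermitianMetric E M) :
    ∃ D : AffineConnection E M, IsChern h D := by
  let N := nonmet h (flat E M)
  have hN := nonmet_J h (flat E M) (fun σ p v hσ ↦ flat_J hσ v)
  have key (p : M) := h.exists_endomorphism p
    (fun s x t ↦ ((N p s t x).re + (N p s t (J p x)).im) / 2)
    (fun _ _ _ _ ↦ by
      simp only [N, map_add (J p), map_smul (J p), nonmet_add₁, nonmet_add₂, nonmet_add₃, nonmet_smul₁, nonmet_smul₂,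
      nonmet_smul₃, Complex.add_re, Complex.smul_re, smul_eq_mul,
      Complex.add_im, Complex.smul_im]
      ring)
    (fun _ _ _ _ ↦ by
      simp only [N, map_add (J p), map_smul (J p), nonmet_add₁, nonmet_add₂, nonmet_add₃, nonmet_smul₁, nonmet_smul₂,
      nonmet_smul₃, Complex.add_re, Complex.smul_re, smul_eq_mul,
      Complex.add_im, Complex.smul_im]
      ring)
    (fun _ _ _ _ ↦ by
      simp only [N, map_add (J p), map_smul (J p), nonmet_add₁, nonmet_add₂, nonmet_add₃, nonmet_smul₁, nonmet_smul₂,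
      nonmet_smul₃, Complex.add_re, Complex.smul_re, smul_eq_mul,
      Complex.add_im, Complex.smul_im]
      ring)
    (fun _ _ _ _ ↦ by
      simp only [N, map_add (J p), map_smul (J p), nonmet_add₁, nonmet_add₂, nonmet_add₃, nonmet_smul₁, nonmet_smul₂,
      nonmet_smul₃, Complex.add_re, Complex.smul_re, smul_eq_mul,
      Complex.add_im, Complex.smul_im]
      ring)
    (fun _ _ _ _ ↦ by
      simp only [N, map_add (J p), map_smul (J p), nonmet_add₁, nonmet_add₂, nonmet_add₃, nonmet_smul₁, nonmet_smul₂,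
      nonmet_smul₃, Complex.add_re, Complex.smul_re, smul_eq_mul,
      Complex.add_im, Complex.smul_im]
      ring)
    (fun _ _ _ _ ↦ by
      simp only [N, map_add (J p), map_smul (J p), nonmet_add₁, nonmet_add₂, nonmet_add₃, nonmet_smul₁, nonmet_smul₂,
      nonmet_smul₃, Complex.add_re, Complex.smul_re, smul_eq_mul,
      Complex.add_im, Complex.smul_im]
      ring)
  choose A hA using key
  have hA' (p : M) (s x t : TangentSpace 𝓘(ℝ, E) p) :
      h.inner p (A p s x) t = (N p s t x - Complex.I * N p s t (J p x)) / 2 := by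
    have h1 : ∀ t, (h.inner p (A p s x) t).re = _ := fun t ↦ hA p s x t
    have h2 := h1 (J p t)
    rw [h.J_right] at h2
    have h3 : ∀ w, N p s (J p t) w = -Complex.I * N p s t w := by
      intro w
      rw [← nonmet_conj, hN, map_mul, nonmet_conj, Complex.conj_I]
    apply Complex.ext
    · rw [h1]; simp
    · simp [h3] at h2; simp [h2]; ring
  have inj (p : M) (u v : TangentSpace 𝓘(ℝ, E) p) (huv : ∀ t, h.inner p u t = h.inner p v t) :
      u = v := by
    by_contra hne
    have := h.pos p (u - v) (sub_ne_zero.2 hne)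
    have h0 : h.inner p (u - v) (u - v) = 0 := by
      have := huv (u - v)
      rw [map_sub (h.inner p) u v]
      exact sub_eq_zero.2 this
    rw [h0] at this
    exact lt_irrefl _ this
  have A_J₁ (p : M) (s x : TangentSpace 𝓘(ℝ, E) p) : A p (J p s) x = J p (A p s x) := by
    apply inj; intro t
    rw [hA', h.J_left, hA', hN, hN]; ring
  have A_J₂ (p : M) (s x : TangentSpace 𝓘(ℝ, E) p) : A p s (J p x) = J p (A p s x) := by
    apply inj; intro t
    rw [hA', h.J_left, hA', J_J, map_neg]
    linear_combination (N p s t (J p x) / 2) * Complex.I_sq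
  have h4 (σ : VField E M) (p : M) (v : TangentSpace 𝓘(ℝ, E) p) :
    (flat E M).addOneForm A σ p v = flat E M σ p v + A p (σ p) v := rfl
  refine ⟨(flat E M).addOneForm A, ?_, ?_, ?_⟩
  · intro X σ p hσ
    rw [h4, h4, flat_J hσ, A_J₁, map_add]
  · intro X σ τ p hσ hτ
    have h1 := nonmet_apply h (flat E M) hσ hτ (X p)
    have h2 := hA' p (σ p) (X p) (τ p)
    have h3 : h.inner p (σ p) (A p (τ p) (X p)) =
        (N p (σ p) (τ p) (X p) + Complex.I * N p (σ p) (τ p) (J p (X p))) / 2 := by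
      rw [← h.conj_symm, hA', map_div₀, map_sub, map_mul, Complex.conj_I,
        nonmet_conj h (flat E M) p (σ p), nonmet_conj h (flat E M) p (σ p), map_ofNat]
      ring
    rw [h4, h4, map_add, map_add, add_apply, h2, h3]
    linear_combination -h1
  · intro X σ p hσ
    rw [h4, h4, flat_holomorphic hσ, A_J₂, map_add]

end Existence

section Uniqueness
variable {E : Type*} [NormedAddCommGroup E] [NormedSpace ℂ E] [FiniteDimensional ℂ E]
  {M : Type*} [TopologicalSpace M] [ChartedSpace E M] [IsManifold 𝓘(ℂ, E) ω M]

theorem exists_holomorphic_extension (p : M) (u : TangentSpace 𝓘(ℝ, E) p) :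
    ∃ σ : VField E M, IsHolomorphicAt σ p ∧ σ p = u :=
  ⟨fun q ↦ FiberBundle.extend E (E := (TangentSpace 𝓘(ℂ, E) : M → Type _)) (x := p) u q,
    FiberBundle.mdifferentiableAt_extend 𝓘(ℂ, E) E (V := (TangentSpace 𝓘(ℂ, E) : M → Type _)) u,
    FiberBundle.extend_apply_self (E := (TangentSpace 𝓘(ℂ, E) : M → Type _)) E u⟩

theorem exists_extension (p : M) (u : TangentSpace 𝓘(ℝ, E) p) :
    ∃ σ : VField E M, IsDifferentiableAt σ p ∧ σ p = u :=
  ⟨FiberBundle.extend E u, FiberBundle.mdifferentiableAt_extend .., by simp⟩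

theorem IsLeviCivita.unique {h : HermitianMetric E M} {D D' : AffineConnection E M}
    (hD : IsLeviCivita h D) (hD' : IsLeviCivita h D') {σ : VField E M} {p : M}
    (hσ : IsDifferentiableAt σ p) : D σ p = D' σ p := by
  let A := D.difference D' p
  have hA : ∀ {σ : VField E M}, IsDifferentiableAt σ p → ∀ v, A (σ p) v = D σ p v - D' σ p v :=
    fun {σ} hσ v ↦ congr($(IsCovariantDerivativeOn.difference_apply D.isCovariantDerivativeOnUniv
      D'.isCovariantDerivativeOnUniv (Set.mem_univ p) hσ) v)
  have A_symm : ∀ x y, A x y = A y x := by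
    intro x y
    obtain ⟨X, hX, rfl⟩ := exists_extension p x
    obtain ⟨Y, hY, rfl⟩ := exists_extension p y
    rw [hA hX, hA hY]
    have h1 := (D.torsion_eq_zero_iff).1 hD.torsion_eq_zero hX hY
    have h2 := (D'.torsion_eq_zero_iff).1 hD'.torsion_eq_zero hX hY
    rw [← sub_eq_zero] at h1 h2 ⊢
    have h3 := congrArg₂ (· - ·) h2 h1
    simp only [sub_zero] at h3
    rw [← h3]; abel
  have A_skew : ∀ x y z, h.metric p (A x z) y = -h.metric p (A y z) x := by
    intro x y z
    obtain ⟨X, hX, rfl⟩ := exists_extension p x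
    obtain ⟨Y, hY, rfl⟩ := exists_extension p y
    obtain ⟨Z, hZ, rfl⟩ := exists_extension p z
    have h1 := hD.metric (X := Z) hX hY
    have h2 := hD'.metric (X := Z) hX hY
    have h3 := h.metric_add p (D X p (Z p) - D' X p (Z p)) (D' X p (Z p)) (Y p)
    have h4 := h.metric_add p (D Y p (Z p) - D' Y p (Z p)) (D' Y p (Z p)) (X p)
    rw [sub_add_cancel] at h3 h4
    rw [h.metric_symm p (X p)] at h1 h2
    rw [hA hX, hA hY]
    linarith
  ext v
  rw [← sub_eq_zero, ← hA hσ]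
  by_contra hne
  have h0 : ∀ x y z, h.metric p (A x y) z = 0 := by
    intro x y z
    have h1 := A_skew x y z
    have h2 := A_skew x z y
    have h3 := A_skew y z x
    rw [A_symm y z] at h1
    rw [A_symm y x, A_symm z x] at h3
    linarith
  exact (h.pos p _ hne).ne' (h0 _ _ _)

theorem IsChern.unique {h : HermitianMetric E M} {D D' : AffineConnection E M}
    (hD : IsChern h D) (hD' : IsChern h D') {σ : VField E M} {p : M}
    (hσ : IsDifferentiableAt σ p) : D σ p = D' σ p := by
  let A := D.difference D' p
  have hA : ∀ {σ : VField E M}, IsDifferentiableAt σ p → ∀ v, A (σ p) v = D σ p v - D' σ p v :=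
    fun {σ} hσ v ↦ congr($(IsCovariantDerivativeOn.difference_apply D.isCovariantDerivativeOnUniv
      D'.isCovariantDerivativeOnUniv (Set.mem_univ p) hσ) v)
  have A_J : ∀ x z, A x (J p z) = J p (A x z) := by
    intro x z
    obtain ⟨X, hX, rfl⟩ := exists_holomorphic_extension p x
    obtain ⟨Z, hZ, rfl⟩ := exists_extension p z
    rw [hA hX.isDifferentiableAt, hA hX.isDifferentiableAt, hD.holomorphic hX,
      hD'.holomorphic hX, map_sub]
  have A_skew : ∀ x y z, h.inner p (A x z) y = -h.inner p x (A y z) := by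
    intro x y z
    obtain ⟨X, hX, rfl⟩ := exists_extension p x
    obtain ⟨Y, hY, rfl⟩ := exists_extension p y
    obtain ⟨Z, hZ, rfl⟩ := exists_extension p z
    have h1 := hD.metric (X := Z) hX hY
    have h2 := hD'.metric (X := Z) hX hY
    have h3 : h.inner p (D X p (Z p) - D' X p (Z p)) (Y p) =
        h.inner p (D X p (Z p)) (Y p) - h.inner p (D' X p (Z p)) (Y p) :=
      congr($((h.inner p).map_sub _ _) (Y p))
    rw [hA hX, hA hY, h3, map_sub]
    linear_combination h2 - h1
  ext v
  rw [← sub_eq_zero, ← hA hσ]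
  by_contra hne
  have h0 : ∀ x y z, h.inner p (A x z) y = 0 := by
    intro x y z
    have h1 := A_skew x y z
    have h2 := A_skew x y (J p z)
    rw [A_J, A_J, h.J_left, h.J_right] at h2
    have h3 : Complex.I * (2 * h.inner p (A x z) y) = 0 := by
      linear_combination h2 + Complex.I * h1
    simpa using h3
  have := h.pos p _ hne
  rw [h0] at this
  exact lt_irrefl _ this

end Uniqueness

section Curvature
variable {E : Type*} [NormedAddCommGroup E] [NormedSpace ℂ E] [FiniteDimensional ℂ E]
  {M : Type*} [TopologicalSpace M] [ChartedSpace E M] [IsManifold 𝓘(ℂ, E) ω M]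

/-- The Levi-Civita connection `∇` of the background Riemannian metric `g = Re h`. (Its value on
differentiable vector fields is unique.) -/
def HermitianMetric.leviCivita (h : HermitianMetric E M) : AffineConnection E M :=
  (exists_isLeviCivita h).choose

theorem HermitianMetric.isLeviCivita (h : HermitianMetric E M) : IsLeviCivita h h.leviCivita :=
  (exists_isLeviCivita h).choose_spec

/-- The connection on the real tangent bundle induced by the Chern connection of `h`. (Its value on
differentiable vector fields is unique.) -/
def HermitianMetric.chern (h : HermitianMetric E M) : AffineConnection E M :=
  (exists_isChern h).choose

theorem HermitianMetric.isChern (h : HermitianMetric E M) : IsChern h h.chern :=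
  (exists_isChern h).choose_spec

/-- The curvature `R(X, Y)Z = D_X D_Y Z - D_Y D_X Z - D_{[X, Y]} Z` of a connection. -/
def curvature (D : AffineConnection E M) (X Y Z : VField E M) (p : M) : TangentSpace 𝓘(ℝ, E) p :=
  D (fun q ↦ D Z q (Y q)) p (X p) - D (fun q ↦ D Z q (X q)) p (Y p)
    - D Z p (VectorField.mlieBracket 𝓘(ℝ, E) X Y p)

/-- The curvature `R(u, v)w` at tangent vectors `u, v, w ∈ T_pM`, computed (as the curvature is
tensorial) on vector fields that extend them and are smooth near `p`. -/
def curvatureAt (D : AffineConnection E M) (p : M) (u v w : TangentSpace 𝓘(ℝ, E) p) :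
    TangentSpace 𝓘(ℝ, E) p :=
  curvature D (FiberBundle.extend E u) (FiberBundle.extend E v) (FiberBundle.extend E w) p

/-- The Riemannian sectional curvature
`K(u, v) = g(R(u, v)v, u) / (g(u, u) g(v, v) - g(u, v)²)` of the plane spanned by `u` and `v`,
where `R` is the curvature of the Levi-Civita connection. -/
def HermitianMetric.riemannSectionalCurvature (h : HermitianMetric E M) (p : M)
    (u v : TangentSpace 𝓘(ℝ, E) p) : ℝ :=
  h.metric p (curvatureAt h.leviCivita p u v v) u /
    (h.metric p u u * h.metric p v v - h.metric p u v ^ 2)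

/-- The Chern sectional curvature
`K_D(u, v) = g((D²u)(v, u), v) / (g(u, u) g(v, v) - g(u, v)²)` of the plane spanned by `u` and `v`,
where `(D²w)(u, v)` is the curvature `R(u, v)w` of (the metric connection induced by) the Chern
connection `D`. -/
def HermitianMetric.chernSectionalCurvature (h : HermitianMetric E M) (p : M)
    (u v : TangentSpace 𝓘(ℝ, E) p) : ℝ :=
  h.metric p (curvatureAt h.chern p v u u) v /
    (h.metric p u u * h.metric p v v - h.metric p u v ^ 2)

/-- The fundamental form `ω(u, v) = g(Ju, v)`. -/
def HermitianMetric.fundamentalForm (h : HermitianMetric E M) (p : M)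
    (u v : TangentSpace 𝓘(ℝ, E) p) : ℝ :=
  h.metric p (J p u) v

/-- The exterior derivative of the fundamental form, by the invariant formula
`dω(X, Y, Z) = X ω(Y, Z) - Y ω(X, Z) + Z ω(X, Y) - ω([X, Y], Z) + ω([X, Z], Y) - ω([Y, Z], X)`. -/
def HermitianMetric.dFundamentalForm (h : HermitianMetric E M) (X Y Z : VField E M) (p : M) : ℝ :=
  mvfderiv 𝓘(ℝ, E) (fun q ↦ h.fundamentalForm q (Y q) (Z q)) p (X p)
    - mvfderiv 𝓘(ℝ, E) (fun q ↦ h.fundamentalForm q (X q) (Z q)) p (Y p)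
    + mvfderiv 𝓘(ℝ, E) (fun q ↦ h.fundamentalForm q (X q) (Y q)) p (Z p)
    - h.fundamentalForm p (VectorField.mlieBracket 𝓘(ℝ, E) X Y p) (Z p)
    + h.fundamentalForm p (VectorField.mlieBracket 𝓘(ℝ, E) X Z p) (Y p)
    - h.fundamentalForm p (VectorField.mlieBracket 𝓘(ℝ, E) Y Z p) (X p)

/-- `h` is a Kähler metric: its fundamental form is closed. -/
def HermitianMetric.IsKahler (h : HermitianMetric E M) : Prop :=
  ∀ (p : M) (X Y Z : VField E M), IsDifferentiableAt X p → IsDifferentiableAt Y p →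
    IsDifferentiableAt Z p → h.dFundamentalForm X Y Z p = 0

end Curvature

end HermitianGeometry

end

/-!
Equality of the two sectional curvatures is needed only on the planes spanned by `u` and `Ju`. Fix
such a plane at `p` and extend `u` to the vector field `X` with constant coefficients in a
holomorphic chart. It is holomorphic, and commutes with `Y = JX`. Put `Z = D_X X`, where `D` is the
Chern connection, so that `D_X Y = D_Y X = JZ` and `D_Y Y = -Z`. With `f = g(X, X) = g(Y, Y)` and
`g(X, Y) = 0`, compatibility with the metric gives at `p`

* `g(R(X, Y)Y, X) = -(XXf + YYf) / 2 + |∇_X Y|² - g(∇_Y Y, ∇_X X)`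
  (`IsLeviCivita.metric_curvatureAt`),
* `g(R^D(Y, X)X, Y) = -(XXf + YYf) / 2 + 2|Z|²` (`IsChern.metric_curvatureAt`).

Let `T` be the torsion of `D` and let `t` represent the linear form `g(X, T(X, ·))`. The Koszul
formula and the complex bilinearity of `T` yield `∇_X X = Z + t`, `∇_Y Y = -Z + t` and
`∇_X Y = JZ` at `p`. Hence the two curvatures differ by `|t|²`, and their equality forces `t = 0`
(`metric_torsion_eq_zero`). As this holds for all `u`, and as `T` is complex bilinear, polarization
gives `T = 0` (`IsChern.torsion_eq_zero`). Finally `dω` is a combination of values of `T`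
(`IsChern.dFundamentalForm_eq`).

The connections are only known pointwise, by uniqueness. That `∇_X Y` and `D_X Y` may be
differentiated once more follows from the formulas for their inner products with coordinate vector
fields, by inverting the metric (`HermitianMetric.isDifferentiableAt_of_metric`).
-/

noncomputable section

namespace HermitianGeometry

/-! ### Vector fields with constant coefficients in a holomorphic chart -/

section CoordinateFields

variable {E : Type*} [NormedAddCommGroup E] [NormedSpace ℂ E]
  {M : Type*} [TopologicalSpace M] [ChartedSpace E M] [IsManifold 𝓘(ℂ, E) ω M]

/-- The vector field with constant coefficients `u` in the holomorphic chart at `p`. It is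
meaningful on the source of that chart, and takes the value `u` at `p`. -/
def coordField (p : M) (u : E) : VField E M :=
  FiberBundle.extend E (E := (TangentSpace 𝓘(ℝ, E) : M → Type _)) (x := p) u

theorem coordField_self (p : M) (u : E) : coordField p u p = u :=
  FiberBundle.extend_apply_self (E := (TangentSpace 𝓘(ℝ, E) : M → Type _)) E (x := p) u

theorem coordField_eq_symm (p : M) (u : E) (q : M) :
    coordField p u q =
      (trivializationAt E (TangentSpace 𝓘(ℝ, E) : M → Type _) p).symm q u := by
  have h1 : (trivializationAt E (TangentSpace 𝓘(ℝ, E) : M → Type _) p ⟨p, u⟩).2 = u :=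
    coord_self p (fun q ↦ (u : E))
  exact congrArg ((trivializationAt E (TangentSpace 𝓘(ℝ, E) : M → Type _) p).symm q) h1

theorem coord_coordField (p : M) (u : E) {q : M} (hq : q ∈ (chartAt E p).source) :
    coord p (coordField p u) q = u := by
  have hq' : q ∈ (trivializationAt E (TangentSpace 𝓘(ℝ, E) : M → Type _) p).baseSet := hq
  rw [coord, coordField_eq_symm, Trivialization.apply_mk_symm _ hq']

theorem eq_of_coord_eq (p : M) {σ τ : VField E M} {q : M} (hq : q ∈ (chartAt E p).source)
    (h : coord p σ q = coord p τ q) : σ q = τ q := by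
  have hq' : q ∈ (trivializationAt E (TangentSpace 𝓘(ℝ, E) : M → Type _) p).baseSet := hq
  have h1 := Trivialization.symm_apply_apply_mk _ hq' (σ q)
  have h2 := Trivialization.symm_apply_apply_mk _ hq' (τ q)
  rw [← h1, ← h2]
  exact congrArg _ h

theorem coordField_coord (p : M) (σ : VField E M) {q : M} (hq : q ∈ (chartAt E p).source) :
    coordField p (coord p σ q) q = σ q :=
  eq_of_coord_eq p hq (coord_coordField p _ hq)

theorem J_coordField (p : M) (u : E) {q : M} (hq : q ∈ (chartAt E p).source) :
    J q (coordField p u q) = coordField p (Complex.I • u) q := by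
  refine eq_of_coord_eq p (σ := fun q ↦ J q (coordField p u q)) hq ?_
  rw [coord_J p _ q hq, coord_coordField p _ hq, coord_coordField p _ hq]

theorem mfderiv_chart_coordField (p : M) (u : E) {q : M} (hq : q ∈ (chartAt E p).source) :
    mfderiv 𝓘(ℝ, E) 𝓘(ℝ, E) (extChartAt 𝓘(ℝ, E) p) q (coordField p u q) = u := by
  have hq' : q ∈ (trivializationAt E (TangentSpace 𝓘(ℝ, E) : M → Type _) p).baseSet := hq
  have h1 := congr($(TangentBundle.continuousLinearMapAt_trivializationAt
    (I := 𝓘(ℝ, E)) hq) (coordField p u q))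
  refine h1.symm.trans ?_
  refine (congrFun (Trivialization.coe_linearMapAt_of_mem (R := ℝ) _ hq') _).trans ?_
  exact coord_coordField p u hq

theorem isHolomorphicAt_coordField (p : M) (u : E) {q : M} (hq : q ∈ (chartAt E p).source) :
    IsHolomorphicAt (coordField p u) q := by
  have hq' : q ∈ (trivializationAt E (TangentSpace 𝓘(ℂ, E) : M → Type _) p).baseSet := hq
  let s : Π x : M, TangentSpace 𝓘(ℂ, E) x := fun x ↦ coordField p u x
  refine (Trivialization.mdifferentiableAt_section_iff 𝓘(ℂ, E)
    (trivializationAt E (TangentSpace 𝓘(ℂ, E) : M → Type _) p) s hq').2 ?_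
  refine (mdifferentiableAt_const (c := u)).congr_of_eventuallyEq ?_
  filter_upwards [(chartAt E p).open_source.mem_nhds hq] with x hx
  exact (coord_eq_complex p _ x hx).symm.trans (coord_coordField p u hx)

theorem isDifferentiableAt_coordField (p : M) (u : E) {q : M} (hq : q ∈ (chartAt E p).source) :
    IsDifferentiableAt (coordField p u) q :=
  (isHolomorphicAt_coordField p u hq).isDifferentiableAt

theorem coordField_eventuallyEq_mpullback (p : M) (u : E) {q : M}
    (hq : q ∈ (chartAt E p).source) :
    coordField p u =ᶠ[nhds q] VectorField.mpullback 𝓘(ℝ, E) 𝓘(ℝ, E) (extChartAt 𝓘(ℝ, E) p)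
      (fun _ ↦ u : Π x : E, TangentSpace 𝓘(ℝ, E) x) := by
  filter_upwards [(chartAt E p).open_source.mem_nhds hq] with x hx
  obtain ⟨e, he⟩ := isInvertible_mfderiv_extChartAt (I := 𝓘(ℝ, E)) (x := p) (y := x)
    (by simpa using hx)
  have h1 := mfderiv_chart_coordField p u hx
  have h2 : (mfderiv 𝓘(ℝ, E) 𝓘(ℝ, E) (extChartAt 𝓘(ℝ, E) p) x).inverse
      (mfderiv 𝓘(ℝ, E) 𝓘(ℝ, E) (extChartAt 𝓘(ℝ, E) p) x (coordField p u x)) =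
      coordField p u x := by
    rw [← he, ContinuousLinearMap.inverse_equiv]
    exact e.symm_apply_apply _
  exact h2.symm.trans (congrArg _ h1)

theorem mlieBracket_coordField [FiniteDimensional ℂ E] (p : M) (u v : E) {q : M}
    (hq : q ∈ (chartAt E p).source) :
    VectorField.mlieBracket 𝓘(ℝ, E) (coordField p u) (coordField p v) q = 0 := by
  have : CompleteSpace E := FiniteDimensional.complete ℂ E
  let c : E → Π x : E, TangentSpace 𝓘(ℝ, E) x := fun w _ ↦ w
  have hc (w x : E) : MDifferentiableAt 𝓘(ℝ, E) (𝓘(ℝ, E).prod 𝓘(ℝ, E))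
      (fun y ↦ (TotalSpace.mk' E (E := (TangentSpace 𝓘(ℝ, E) : E → Type _)) y (c w y))) x :=
    (contMDiffAt_vectorSpace_iff_contDiffAt (n := 1) (V := c w)).2
      (contDiffAt_const (c := w)) |>.mdifferentiableAt one_ne_zero
  have h1 := VectorField.mpullback_mlieBracket (I := 𝓘(ℝ, E)) (n := ω)
    (f := extChartAt 𝓘(ℝ, E) p) (x₀ := q) (hc u _) (hc v _)
    (contMDiffAt_extChartAt' (by simpa using hq)) (by simp)
  have h2 : VectorField.mlieBracket 𝓘(ℝ, E) (c u) (c v) (extChartAt 𝓘(ℝ, E) p q) = 0 := by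
    rw [← VectorField.mlieBracketWithin_univ, VectorField.mlieBracketWithin_eq_lieBracketWithin,
      VectorField.lieBracketWithin_univ]
    have h4 : VectorField.lieBracket ℝ (fun _ : E ↦ u) (fun _ : E ↦ v) = 0 := by
      ext x; simp [VectorField.lieBracket]
    exact congrFun h4 _
  refine ((coordField_eventuallyEq_mpullback p u hq).mlieBracket_vectorField_eq
    (coordField_eventuallyEq_mpullback p v hq)).trans (h1.symm.trans ?_)
  rw [VectorField.mpullback_apply, h2, map_zero]

end CoordinateFields

/-! ### Regularity of vector fields paired with the metric -/

theorem _root_.MDifferentiableAt.inverse_apply {E : Type*} [NormedAddCommGroup E]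
    [NormedSpace ℝ E] [CompleteSpace E] {H : Type*} [NormedAddCommGroup H] [NormedSpace ℝ H]
    {M : Type*} [TopologicalSpace M] [ChartedSpace H M] {F : Type*}
    [NormedAddCommGroup F] [NormedSpace ℝ F] {p : M} {G : M → E →L[ℝ] F} {φ : M → F}
    (hG : MDifferentiableAt 𝓘(ℝ, H) 𝓘(ℝ, E →L[ℝ] F) G p)
    (hφ : MDifferentiableAt 𝓘(ℝ, H) 𝓘(ℝ, F) φ p) {e : E ≃L[ℝ] F}
    (he : (e : E →L[ℝ] F) = G p) :
    MDifferentiableAt 𝓘(ℝ, H) 𝓘(ℝ, E) (fun q ↦ (G q).inverse (φ q)) p := by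
  have h2 : DifferentiableAt ℝ ContinuousLinearMap.inverse (G p) := by
    rw [← he]
    exact (contDiffAt_map_inverse (n := 1) e).differentiableAt one_ne_zero
  exact (h2.comp_mdifferentiableAt hG).clm_apply hφ

section Nondegenerate

variable {E : Type*} [NormedAddCommGroup E] [NormedSpace ℝ E] [FiniteDimensional ℝ E]
  {H : Type*} [NormedAddCommGroup H] [NormedSpace ℝ H]
  {M : Type*} [TopologicalSpace M] [ChartedSpace H M]

/-- Let `g` be a family of bilinear forms with differentiable coefficients, nondegenerate at `p`.
A map `c` to `E` is differentiable at `p` as soon as the functions `g(c, w)` are: it is recovered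
from them with the inverse of `g`. -/
theorem mdifferentiableAt_of_nondegenerate {p : M} {g : M → E →ₗ[ℝ] E →ₗ[ℝ] ℝ}
    (hg : ∀ u v, MDifferentiableAt 𝓘(ℝ, H) 𝓘(ℝ, ℝ) (fun q ↦ g q u v) p)
    (hp : ∀ u, g p u = 0 → u = 0) {c : M → E}
    (hc : ∀ w, MDifferentiableAt 𝓘(ℝ, H) 𝓘(ℝ, ℝ) (fun q ↦ g q (c q) w) p) :
    MDifferentiableAt 𝓘(ℝ, H) 𝓘(ℝ, E) c p := by
  have : CompleteSpace E := FiniteDimensional.complete ℝ E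
  let b := Module.finBasis ℝ E
  let β : Fin (Module.finrank ℝ E) → E →L[ℝ] ℝ := fun i ↦ (b.coord i).toContinuousLinearMap
  -- `g` as a family of continuous bilinear maps, assembled from its matrix in a basis
  let G : M → E →L[ℝ] E →L[ℝ] ℝ := fun q ↦ ∑ i, ∑ j, g q (b i) (b j) • (β i).smulRight (β j)
  have hsum (f : E →ₗ[ℝ] ℝ) (v : E) : f v = ∑ i, b.repr v i * f (b i) := by
    conv_lhs => rw [← b.sum_repr v, map_sum]
    simp only [map_smul, smul_eq_mul]
  have hG : ∀ q u v, G q u v = g q u v := by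
    intro q u v
    have h1 : g q u v = ∑ i, b.repr u i * g q (b i) v := hsum ((g q).flip v) u
    rw [h1, Finset.sum_congr rfl fun i _ ↦ by rw [hsum (g q (b i)) v]]
    simp [G, β, Finset.mul_sum, mul_comm, mul_left_comm]
  have hG' : MDifferentiableAt 𝓘(ℝ, H) 𝓘(ℝ, E →L[ℝ] E →L[ℝ] ℝ) G p := by
    have h1 : G = ∑ i, ∑ j, fun q ↦ g q (b i) (b j) • (β i).smulRight (β j) := by
      ext q; simp [G]
    rw [h1]
    exact MDifferentiableAt.sum fun i _ ↦ MDifferentiableAt.sum fun j _ ↦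
      (hg (b i) (b j)).smul mdifferentiableAt_const
  have hφ : MDifferentiableAt 𝓘(ℝ, H) 𝓘(ℝ, E →L[ℝ] ℝ) (fun q ↦ G q (c q)) p := by
    have h1 : (fun q ↦ G q (c q)) = ∑ i, fun q ↦ g q (c q) (b i) • β i := by
      ext q v
      rw [hG, hsum (g q (c q)) v]
      simp [β, mul_comm]
    rw [h1]
    exact MDifferentiableAt.sum fun i _ ↦ (hc (b i)).smul mdifferentiableAt_const
  obtain ⟨e, he⟩ : ∃ e : E ≃L[ℝ] (E →L[ℝ] ℝ), (e : E →L[ℝ] E →L[ℝ] ℝ) = G p := by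
    have hinj : Function.Injective (G p : E →ₗ[ℝ] E →L[ℝ] ℝ) := by
      rw [injective_iff_map_eq_zero]
      intro u hu
      refine hp u (LinearMap.ext fun v ↦ ?_)
      rw [← hG]
      exact congr($hu v)
    have hfin : Module.finrank ℝ E = Module.finrank ℝ (E →L[ℝ] ℝ) := by
      rw [← (LinearMap.toContinuousLinearMap (𝕜 := ℝ) (E := E) (F' := ℝ)).finrank_eq]
      exact (Subspace.dual_finrank_eq (K := ℝ) (V := E)).symm
    refine ⟨(LinearEquiv.ofInjectiveOfFinrankEq (G p : E →ₗ[ℝ] E →L[ℝ] ℝ)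
      hinj hfin).toContinuousLinearEquiv, ?_⟩
    ext; rfl
  have hinv : ∀ᶠ q in nhds p, c q = (G q).inverse (G q (c q)) := by
    have h1 : ∀ᶠ q in nhds p, G q ∈ Set.range
        (ContinuousLinearEquiv.toContinuousLinearMap : (E ≃L[ℝ] (E →L[ℝ] ℝ)) → _) :=
      hG'.continuousAt.eventually (he ▸ ContinuousLinearEquiv.nhds e)
    filter_upwards [h1] with q ⟨e', he'⟩
    rw [← he', ContinuousLinearMap.inverse_equiv]
    exact (e'.symm_apply_apply _).symm
  exact (hG'.inverse_apply hφ he).congr_of_eventuallyEq hinv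

end Nondegenerate

section MetricCoefficients

variable {E : Type*} [NormedAddCommGroup E] [NormedSpace ℂ E]
  {M : Type*} [TopologicalSpace M] [ChartedSpace E M] [IsManifold 𝓘(ℂ, E) ω M]

theorem contMDiffAt_coordField (p : M) (u : E) {q : M} (hq : q ∈ (chartAt E p).source) :
    ContMDiffAt 𝓘(ℝ, E) (𝓘(ℝ, E).prod 𝓘(ℝ, E)) ∞ (fun q ↦ TotalSpace.mk' E
      (E := (TangentSpace 𝓘(ℝ, E) : M → Type _)) q (coordField p u q)) q := by
  have hq' : q ∈ (trivializationAt E (TangentSpace 𝓘(ℝ, E) : M → Type _) p).baseSet := hq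
  refine ((trivializationAt E (TangentSpace 𝓘(ℝ, E) : M → Type _) p).contMDiffAt_section_iff
    hq').2 ?_
  refine (contMDiffAt_const (c := u)).congr_of_eventuallyEq ?_
  filter_upwards [(chartAt E p).open_source.mem_nhds hq] with x hx
  exact coord_coordField p u hx

theorem HermitianMetric.contMDiffOn_inner_coordField (h : HermitianMetric E M) (p : M) (u v : E) :
    ContMDiffOn 𝓘(ℝ, E) 𝓘(ℝ, ℂ) ∞ (fun q ↦ h.inner q (coordField p u q) (coordField p v q))
      (chartAt E p).source := by
  intro q hq
  have : ContMDiffAt 𝓘(ℝ, E) (𝓘(ℝ, E).prod 𝓘(ℝ, ℂ)) ∞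
      (fun m ↦ TotalSpace.mk' ℂ (E := Bundle.Trivial M ℂ) m
        (h.inner m (coordField p u m) (coordField p v m))) q := by
    apply ContMDiffAt.clm_bundle_apply₂ (F₁ := E) (F₂ := E)
    · exact h.contMDiff q
    · exact contMDiffAt_coordField p u hq
    · exact contMDiffAt_coordField p v hq
  simp only [contMDiffAt_totalSpace] at this
  exact this.2.contMDiffWithinAt

theorem HermitianMetric.contMDiffOn_metric_coordField (h : HermitianMetric E M) (p : M) (u v : E) :
    ContMDiffOn 𝓘(ℝ, E) 𝓘(ℝ, ℝ) ∞ (fun q ↦ h.metric q (coordField p u q) (coordField p v q))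
      (chartAt E p).source :=
  Complex.reCLM.contDiff.contMDiff.comp_contMDiffOn (h.contMDiffOn_inner_coordField p u v)

/-- The derivative along a coordinate vector field is a directional derivative in the chart. -/
theorem mvfderiv_coordField {F : Type*} [NormedAddCommGroup F] [NormedSpace ℝ F] {p : M}
    {f : M → F} {q : M}
    (hq : q ∈ (chartAt E p).source) (hf : MDifferentiableAt 𝓘(ℝ, E) 𝓘(ℝ, F) f q) (w : E) :
    mvfderiv 𝓘(ℝ, E) f q (coordField p w q) =
      fderiv ℝ (f ∘ (chartAt E p).symm) (chartAt E p q) w := by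
  have h1 : f =ᶠ[nhds q] (f ∘ (chartAt E p).symm) ∘ extChartAt 𝓘(ℝ, E) p := by
    filter_upwards [(chartAt E p).open_source.mem_nhds hq] with x hx
    simp [(chartAt E p).left_inv hx]
  have h2 : MDifferentiableAt 𝓘(ℝ, E) 𝓘(ℝ, E) (extChartAt 𝓘(ℝ, E) p) q :=
    mdifferentiableAt_extChartAt hq
  have h3 : MDifferentiableAt 𝓘(ℝ, E) 𝓘(ℝ, F) (f ∘ (chartAt E p).symm)
      (extChartAt 𝓘(ℝ, E) p q) := by
    have h4 : MDifferentiableAt 𝓘(ℝ, E) 𝓘(ℝ, E) (chartAt E p).symm (chartAt E p q) :=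
      mdifferentiableAt_atlas_symm (chart_mem_atlas E p) ((chartAt E p).map_source hq)
    have h5 : MDifferentiableAt 𝓘(ℝ, E) 𝓘(ℝ, F) f ((chartAt E p).symm (chartAt E p q)) := by
      rwa [(chartAt E p).left_inv hq]
    exact h5.comp _ h4
  have h6 := (h3.hasMFDerivAt.comp q h2.hasMFDerivAt).congr_of_eventuallyEq h1
  refine congr($(h6.mfderiv) (coordField p w q)).trans ?_
  refine (congrArg _ (mfderiv_chart_coordField p w hq)).trans ?_
  rw [mfderiv_eq_fderiv]
  rfl

theorem mdifferentiableAt_mvfderiv_coordField {F : Type*} [NormedAddCommGroup F] [NormedSpace ℝ F]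
    {p : M} {f : M → F}
    (hf : ContMDiffOn 𝓘(ℝ, E) 𝓘(ℝ, F) ∞ f (chartAt E p).source) (w : E) :
    MDifferentiableAt 𝓘(ℝ, E) 𝓘(ℝ, F)
      (fun q ↦ mvfderiv 𝓘(ℝ, E) f q (coordField p w q)) p := by
  have hd : ∀ q ∈ (chartAt E p).source, ContMDiffAt 𝓘(ℝ, E) 𝓘(ℝ, F) ∞ f q :=
    fun q hq ↦ hf.contMDiffAt ((chartAt E p).open_source.mem_nhds hq)
  have h1 : ContDiffAt ℝ ∞ (f ∘ (chartAt E p).symm) (chartAt E p p) := by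
    have h2 : ContMDiffAt 𝓘(ℝ, E) 𝓘(ℝ, E) ∞ (chartAt E p).symm (chartAt E p p) :=
      (contMDiffOn_chart_symm (I := 𝓘(ℝ, E)) (n := ∞)).contMDiffAt
        ((chartAt E p).open_target.mem_nhds (mem_chart_target E p))
    have h3 : ContMDiffAt 𝓘(ℝ, E) 𝓘(ℝ, F) ∞ f ((chartAt E p).symm (chartAt E p p)) := by
      rw [(chartAt E p).left_inv (mem_chart_source E p)]
      exact hd p (mem_chart_source E p)
    exact (h3.comp _ h2).contDiffAt
  have h2 : (1 + 1 : WithTop ℕ∞) ≤ ∞ := by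
    norm_num
    exact WithTop.coe_le_coe.2 (le_top : (2 : ℕ∞) ≤ ⊤)
  have h4 : DifferentiableAt ℝ (fun y ↦ fderiv ℝ (f ∘ (chartAt E p).symm) y w)
      (extChartAt 𝓘(ℝ, E) p p) :=
    ((h1.fderiv_right (m := 1) h2).differentiableAt one_ne_zero).clm_apply
      (differentiableAt_const w)
  have h5 : MDifferentiableAt 𝓘(ℝ, E) 𝓘(ℝ, E) (extChartAt 𝓘(ℝ, E) p) p :=
    mdifferentiableAt_extChartAt (mem_chart_source E p)
  refine (h4.comp_mdifferentiableAt h5).congr_of_eventuallyEq ?_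
  filter_upwards [(chartAt E p).open_source.mem_nhds (mem_chart_source E p)] with q hq
  rw [mvfderiv_coordField hq ((hd q hq).mdifferentiableAt (by simp))]
  rfl

theorem coordField_eq_symmₗ (p : M) (u : E) {q : M} (hq : q ∈ (chartAt E p).source) :
    coordField p u q =
      (trivializationAt E (TangentSpace 𝓘(ℝ, E) : M → Type _) p).symmₗ ℝ q u := by
  have hq' : q ∈ (trivializationAt E (TangentSpace 𝓘(ℝ, E) : M → Type _) p).baseSet := hq
  rw [coordField_eq_symm, Trivialization.symmₗ_apply _ hq']

/-- A vector field is differentiable as soon as its inner products with the coordinate vector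
fields are. -/
theorem HermitianMetric.isDifferentiableAt_of_metric [FiniteDimensional ℂ E]
    (h : HermitianMetric E M) {p : M} {σ : VField E M}
    (hσ : ∀ w : E, MDifferentiableAt 𝓘(ℝ, E) 𝓘(ℝ, ℝ)
      (fun q ↦ h.metric q (σ q) (coordField p w q)) p) : IsDifferentiableAt σ p := by
  have : FiniteDimensional ℝ E := FiniteDimensional.complexToReal E
  have hp := mem_chart_source E p
  -- `symmₗ` agrees with the coordinate fields on the chart domain, and is linear everywhere
  let B (q : M) : TangentSpace 𝓘(ℝ, E) q →ₗ[ℝ] TangentSpace 𝓘(ℝ, E) q →ₗ[ℝ] ℝ :=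
    LinearMap.mk₂ ℝ (h.metric q) (h.metric_add q) (h.metric_smul q)
      (fun u v w ↦ h.metric_add' q v w u) (fun c u v ↦ h.metric_smul' q c v u)
  let L (q : M) : E →ₗ[ℝ] TangentSpace 𝓘(ℝ, E) q :=
    (trivializationAt E (TangentSpace 𝓘(ℝ, E) : M → Type _) p).symmₗ ℝ q
  let g (q : M) : E →ₗ[ℝ] E →ₗ[ℝ] ℝ := (B q).compl₁₂ (L q) (L q)
  have hg {q : M} (hq : q ∈ (chartAt E p).source) (u v : E) :
      g q u v = h.metric q (coordField p u q) (coordField p v q) := by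
    rw [coordField_eq_symmₗ p u hq, coordField_eq_symmₗ p v hq]
    rfl
  have hs := (chartAt E p).open_source.mem_nhds hp
  rw [isDifferentiableAt_iff]
  refine mdifferentiableAt_of_nondegenerate (g := g) (fun u v ↦ ?_) (fun u hu ↦ ?_) (fun w ↦ ?_)
  · refine (((h.contMDiffOn_metric_coordField p u v).contMDiffAt
      hs).mdifferentiableAt (by simp)).congr_of_eventuallyEq ?_
    filter_upwards [hs] with q hq using hg hq u v
  · by_contra hne
    have h1 := (hg hp u u).symm.trans congr($hu u)
    rw [coordField_self] at h1
    exact (h.pos p u hne).ne' h1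
  · refine (hσ w).congr_of_eventuallyEq ?_
    filter_upwards [hs] with q hq
    rw [hg hq, coordField_coord p σ hq]

end MetricCoefficients

/-! ### The two connections on coordinate vector fields -/

section MetricAlgebra

variable {E : Type*} [NormedAddCommGroup E] [NormedSpace ℂ E] [FiniteDimensional ℂ E]
  {M : Type*} [TopologicalSpace M] [ChartedSpace E M] [IsManifold 𝓘(ℂ, E) ω M]
  (h : HermitianMetric E M) (p : M) (u v w : TangentSpace 𝓘(ℝ, E) p)

theorem HermitianMetric.metric_neg : h.metric p (-u) w = -h.metric p u w := by
  simp [HermitianMetric.metric]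

theorem HermitianMetric.metric_sub :
    h.metric p (u - v) w = h.metric p u w - h.metric p v w := by
  simp [HermitianMetric.metric]

theorem HermitianMetric.metric_neg' : h.metric p w (-u) = -h.metric p w u := by
  simp [HermitianMetric.metric]

theorem HermitianMetric.metric_sub' :
    h.metric p w (u - v) = h.metric p w u - h.metric p w v := by
  simp [HermitianMetric.metric]

theorem HermitianMetric.metric_J_J : h.metric p (J p u) (J p v) = h.metric p u v := by
  simp [HermitianMetric.metric, h.J_left, h.J_right]

theorem HermitianMetric.metric_J_left : h.metric p (J p u) v = -h.metric p u (J p v) := by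
  simp [HermitianMetric.metric, h.J_left, h.J_right]

theorem HermitianMetric.metric_J_self : h.metric p u (J p u) = 0 := by
  have h1 := h.metric_J_left p u u
  rw [h.metric_symm] at h1
  linarith

theorem HermitianMetric.metric_zero : h.metric p 0 w = 0 := by
  simp [HermitianMetric.metric]

variable {p} in
theorem HermitianMetric.eq_of_metric_eq {u v : TangentSpace 𝓘(ℝ, E) p}
    (huv : ∀ w, h.metric p u w = h.metric p v w) : u = v := by
  by_contra hne
  refine (h.pos p _ (sub_ne_zero.2 hne)).ne' ?_
  change h.metric p (u - v) (u - v) = 0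
  rw [h.metric_sub, huv, sub_self]

end MetricAlgebra

section CoordinateConnections

variable {E : Type*} [NormedAddCommGroup E] [NormedSpace ℂ E] [FiniteDimensional ℂ E]
  {M : Type*} [TopologicalSpace M] [ChartedSpace E M] [IsManifold 𝓘(ℂ, E) ω M]
  {h : HermitianMetric E M} {D : AffineConnection E M}

theorem IsChern.metric_re (hD : IsChern h D) {X σ τ : VField E M} {p : M}
    (hσ : IsDifferentiableAt σ p) (hτ : IsDifferentiableAt τ p) :
    mvfderiv 𝓘(ℝ, E) (fun q ↦ h.metric q (σ q) (τ q)) p (X p) =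
      h.metric p (D σ p (X p)) (τ p) + h.metric p (σ p) (D τ p (X p)) := by
  rw [mvfderiv_re h hσ hτ, hD.metric hσ hτ, Complex.add_re]
  rfl

theorem IsChern.apply_J_coordField (hD : IsChern h D) (p : M) (v : E) {q : M}
    (hq : q ∈ (chartAt E p).source) (x : TangentSpace 𝓘(ℝ, E) q) :
    D (coordField p v) q (J q x) = J q (D (coordField p v) q x) := by
  obtain ⟨X, -, rfl⟩ := exists_extension q x
  exact hD.holomorphic (isHolomorphicAt_coordField p v hq)

theorem congr_of_eventuallyEq (D : AffineConnection E M) {σ τ : VField E M} {p : M}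
    (hσ : IsDifferentiableAt σ p) (hτ : IsDifferentiableAt τ p) (h : σ =ᶠ[nhds p] τ) :
    D σ p = D τ p :=
  D.isCovariantDerivativeOnUniv.congr_of_eventuallyEq hσ hτ Filter.univ_mem h

theorem IsChern.apply_coordField_I_smul (hD : IsChern h D) (p : M) (v : E) {q : M}
    (hq : q ∈ (chartAt E p).source) (x : TangentSpace 𝓘(ℝ, E) q) :
    D (coordField p (Complex.I • v)) q x = J q (D (coordField p v) q x) := by
  have h1 : coordField p (Complex.I • v) =ᶠ[nhds q] fun q ↦ J q (coordField p v q) := by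
    filter_upwards [(chartAt E p).open_source.mem_nhds hq] with y hy
    exact (J_coordField p v hy).symm
  have h2 := isDifferentiableAt_coordField p v hq
  rw [congr_of_eventuallyEq D (isDifferentiableAt_coordField p _ hq) h2.J h1]
  obtain ⟨X, -, rfl⟩ := exists_extension q x
  exact hD.complex h2

theorem IsLeviCivita.apply_coordField_comm (hD : IsLeviCivita h D) (p : M) (u v : E) {q : M}
    (hq : q ∈ (chartAt E p).source) :
    D (coordField p v) q (coordField p u q) = D (coordField p u) q (coordField p v q) := by
  have h1 := (D.torsion_eq_zero_iff).1 hD.torsion_eq_zero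
    (isDifferentiableAt_coordField p u hq) (isDifferentiableAt_coordField p v hq)
  exact sub_eq_zero.1 (h1.trans (mlieBracket_coordField p u v hq))

/-- The Koszul formula on coordinate vector fields. -/
theorem IsLeviCivita.koszul (hD : IsLeviCivita h D) (p : M) (u v w : E) {q : M}
    (hq : q ∈ (chartAt E p).source) :
    2 * h.metric q (D (coordField p v) q (coordField p u q)) (coordField p w q) =
      mvfderiv 𝓘(ℝ, E) (fun x ↦ h.metric x (coordField p v x) (coordField p w x)) q
          (coordField p u q)
        + mvfderiv 𝓘(ℝ, E) (fun x ↦ h.metric x (coordField p u x) (coordField p w x)) q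
          (coordField p v q)
        - mvfderiv 𝓘(ℝ, E) (fun x ↦ h.metric x (coordField p u x) (coordField p v x)) q
          (coordField p w q) := by
  have hd := fun x ↦ isDifferentiableAt_coordField p x hq
  rw [hD.metric (hd v) (hd w), hD.metric (hd u) (hd w), hD.metric (hd u) (hd v),
    hD.apply_coordField_comm p v u hq, hD.apply_coordField_comm p w u hq,
    hD.apply_coordField_comm p w v hq,
    h.metric_symm q (coordField p v q) (D (coordField p w) q (coordField p u q))]
  ring

/-- The Chern connection on coordinate vector fields, in terms of the metric coefficients. As the
fields are holomorphic, the derivatives along `u` and `√-1 u` together isolate `D_u v`. -/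
theorem IsChern.koszul (hD : IsChern h D) (p : M) (u v w : E) {q : M}
    (hq : q ∈ (chartAt E p).source) :
    2 * h.metric q (D (coordField p v) q (coordField p u q)) (coordField p w q) =
      mvfderiv 𝓘(ℝ, E) (fun x ↦ h.metric x (coordField p v x) (coordField p w x)) q
          (coordField p u q)
        - mvfderiv 𝓘(ℝ, E)
          (fun x ↦ h.metric x (coordField p (Complex.I • v) x) (coordField p w x)) q
          (coordField p (Complex.I • u) q) := by
  have hd := fun x ↦ isDifferentiableAt_coordField p x hq
  rw [hD.metric_re (hd v) (hd w), hD.metric_re (hd _) (hd w), hD.apply_coordField_I_smul p v hq,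
    ← J_coordField p u hq, ← J_coordField p v hq, hD.apply_J_coordField p v hq,
    hD.apply_J_coordField p w hq, J_J, h.metric_neg, h.metric_J_J]
  ring

theorem mdifferentiableAt_mvfderiv_metric (h : HermitianMetric E M) (p : M) (u v w : E) :
    MDifferentiableAt 𝓘(ℝ, E) 𝓘(ℝ, ℝ) (fun q ↦ mvfderiv 𝓘(ℝ, E)
      (fun x ↦ h.metric x (coordField p v x) (coordField p w x)) q (coordField p u q)) p :=
  mdifferentiableAt_mvfderiv_coordField (h.contMDiffOn_metric_coordField p v w) u

theorem isDifferentiableAt_of_two_mul_metric {p : M} {σ : VField E M} (f : E → M → ℝ)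
    (hf : ∀ w, MDifferentiableAt 𝓘(ℝ, E) 𝓘(ℝ, ℝ) (f w) p)
    (hσ : ∀ w, ∀ q ∈ (chartAt E p).source, 2 * h.metric q (σ q) (coordField p w q) = f w q) :
    IsDifferentiableAt σ p := by
  refine h.isDifferentiableAt_of_metric fun w ↦ ?_
  refine ((mdifferentiableAt_const (c := (1 / 2 : ℝ))).mul (hf w)).congr_of_eventuallyEq ?_
  filter_upwards [(chartAt E p).open_source.mem_nhds (mem_chart_source E p)] with q hq
  simp only [Pi.mul_apply]
  rw [← hσ w q hq]
  ring

/-- Covariant derivatives of coordinate vector fields are differentiable, so that the second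
covariant derivatives in the curvature obey the Leibniz rules. -/
theorem IsLeviCivita.isDifferentiableAt_apply_coordField (hD : IsLeviCivita h D) (p : M)
    (u v : E) :
    IsDifferentiableAt (fun q ↦ D (coordField p v) q (coordField p u q)) p :=
  isDifferentiableAt_of_two_mul_metric _ (fun w ↦
    ((mdifferentiableAt_mvfderiv_metric h p u v w).add
      (mdifferentiableAt_mvfderiv_metric h p v u w)).sub
      (mdifferentiableAt_mvfderiv_metric h p w u v)) fun w _ hq ↦ hD.koszul p u v w hq

theorem IsChern.isDifferentiableAt_apply_coordField (hD : IsChern h D) (p : M) (u v : E) :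
    IsDifferentiableAt (fun q ↦ D (coordField p v) q (coordField p u q)) p :=
  isDifferentiableAt_of_two_mul_metric _ (fun w ↦
    (mdifferentiableAt_mvfderiv_metric h p u v w).sub
      (mdifferentiableAt_mvfderiv_metric h p (Complex.I • u) (Complex.I • v) w))
      fun w _ hq ↦ hD.koszul p u v w hq

end CoordinateConnections

/-! ### Curvature in holomorphic directions -/

section HolomorphicSectionalCurvature

variable {E : Type*} [NormedAddCommGroup E] [NormedSpace ℂ E] [FiniteDimensional ℂ E]
  {M : Type*} [TopologicalSpace M] [ChartedSpace E M] [IsManifold 𝓘(ℂ, E) ω M]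
  {h : HermitianMetric E M} {D : AffineConnection E M}

/-- The second derivative `x x g(u, u)` at `p`, where `x` and `u` stand for the vector fields with
these constant coefficients in the chart at `p`. -/
def HermitianMetric.secondDeriv (h : HermitianMetric E M) (p : M) (x u : E) : ℝ :=
  mvfderiv 𝓘(ℝ, E) (fun q ↦ mvfderiv 𝓘(ℝ, E)
    (fun y ↦ h.metric y (coordField p u y) (coordField p u y)) q (coordField p x q)) p
    (coordField p x p)

theorem mvfderiv_congr {f g : M → ℝ} {p : M} (hfg : f =ᶠ[nhds p] g) :
    mvfderiv 𝓘(ℝ, E) f p = mvfderiv 𝓘(ℝ, E) g p := by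
  ext v
  exact congr($(hfg.mfderiv_eq (I := 𝓘(ℝ, E)) (I' := 𝓘(ℝ, ℝ))) v)

theorem mvfderiv_const_mul {f : M → ℝ} {p : M} (hf : MDifferentiableAt 𝓘(ℝ, E) 𝓘(ℝ, ℝ) f p)
    (c : ℝ) (v : TangentSpace 𝓘(ℝ, E) p) :
    mvfderiv 𝓘(ℝ, E) (fun q ↦ c * f q) p v = c * mvfderiv 𝓘(ℝ, E) f p v := by
  have h1 := mvfderiv_mul (mdifferentiableAt_const (I := 𝓘(ℝ, E)) (x := p) (c := c)) hf
  rw [mvfderiv_const, smul_zero, add_zero] at h1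
  exact congr($h1 v)

theorem mvfderiv_metric_self (hD : ∀ {X σ τ : VField E M} {p : M}, IsDifferentiableAt σ p →
      IsDifferentiableAt τ p → mvfderiv 𝓘(ℝ, E) (fun q ↦ h.metric q (σ q) (τ q)) p (X p) =
      h.metric p (D σ p (X p)) (τ p) + h.metric p (σ p) (D τ p (X p)))
    (p : M) (u v : E) {q : M} (hq : q ∈ (chartAt E p).source) :
    mvfderiv 𝓘(ℝ, E) (fun y ↦ h.metric y (coordField p u y) (coordField p u y)) q
      (coordField p v q) =
      2 * h.metric q (D (coordField p u) q (coordField p v q)) (coordField p u q) := by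
  have hd := isDifferentiableAt_coordField p u hq
  rw [hD hd hd, h.metric_symm q (coordField p u q)]
  ring

/-- The curvature in the holomorphic direction `u` of the Levi-Civita connection: the usual formula
for two commuting fields `X`, `Y`, simplified by `Y = JX`, so that `g(X, Y) = 0` and
`g(Y, Y) = g(X, X)`. -/
theorem IsLeviCivita.metric_curvatureAt (hD : IsLeviCivita h D) (p : M) (u : E) :
    h.metric p (curvatureAt D p u (J p u) (J p u)) u =
      -(h.secondDeriv p u u + h.secondDeriv p (Complex.I • u) u) / 2
      + h.metric p (D (coordField p (Complex.I • u)) p u) (D (coordField p (Complex.I • u)) p u)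
      - h.metric p (D (coordField p (Complex.I • u)) p (Complex.I • u : E))
        (D (coordField p u) p u) := by
  have hp := mem_chart_source E p
  have hs := (chartAt E p).open_source.mem_nhds hp
  set X : VField E M := coordField p u
  set Y : VField E M := coordField p (Complex.I • u)
  have hd := fun x {q} (hq : q ∈ (chartAt E p).source) ↦ isDifferentiableAt_coordField p x hq
  have hXp : X p = u := coordField_self p u
  have hYp : Y p = (Complex.I • u : E) := coordField_self p _
  let A : VField E M := fun q ↦ D Y q (Y q)
  let B : VField E M := fun q ↦ D Y q (X q)
  have hA : IsDifferentiableAt A p := hD.isDifferentiableAt_apply_coordField p _ _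
  have hB : IsDifferentiableAt B p := hD.isDifferentiableAt_apply_coordField p _ _
  have hJ : ∀ q ∈ (chartAt E p).source, Y q = J q (X q) :=
    fun q hq ↦ (J_coordField p u hq).symm
  have hBC : ∀ q ∈ (chartAt E p).source, D X q (Y q) = B q :=
    fun q hq ↦ hD.apply_coordField_comm p _ u hq
  have hsmooth (x : E) := mdifferentiableAt_mvfderiv_metric h p x u u
  have hf : ∀ q ∈ (chartAt E p).source, (fun x ↦ h.metric x (Y x) (Y x)) =ᶠ[nhds q]
      (fun x ↦ h.metric x (X x) (X x)) := by
    intro q hq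
    filter_upwards [(chartAt E p).open_source.mem_nhds hq] with y hy
    rw [hJ y hy, h.metric_J_J]
  have h0 : ∀ q ∈ (chartAt E p).source, (fun x ↦ h.metric x (Y x) (X x)) =ᶠ[nhds q]
      (fun x ↦ (0 : ℝ)) := by
    intro q hq
    filter_upwards [(chartAt E p).open_source.mem_nhds hq] with y hy
    rw [hJ y hy, h.metric_symm, h.metric_J_self]
  -- `g(∇_Y Y, X) = Y g(Y, X) - g(Y, ∇_X Y)`, where the first term vanishes identically
  have hAX : (fun q ↦ h.metric q (A q) (X q)) =ᶠ[nhds p] fun q ↦ (-1 / 2) *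
      mvfderiv 𝓘(ℝ, E) (fun y ↦ h.metric y (X y) (X y)) q (X q) := by
    filter_upwards [hs] with q hq
    have h1 := hD.metric (X := Y) (hd (Complex.I • u) hq) (hd u hq)
    rw [mvfderiv_congr (h0 q hq), mvfderiv_const] at h1
    have h2 := mvfderiv_metric_self hD.metric p (Complex.I • u) u hq
    rw [mvfderiv_congr (hf q hq)] at h2
    have h3 : (0 : ℝ) = h.metric q (A q) (X q) + h.metric q (Y q) (D X q (Y q)) := h1
    rw [hBC q hq, h.metric_symm q (Y q)] at h3
    rw [h2]
    change _ = (-1 / 2) * (2 * h.metric q (B q) (Y q))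
    linarith
  -- `g(∇_X Y, X) = g(∇_Y X, X)`, half the derivative of `g(X, X)` along `Y`
  have hBX : (fun q ↦ h.metric q (B q) (X q)) =ᶠ[nhds p] fun q ↦ (1 / 2) *
      mvfderiv 𝓘(ℝ, E) (fun y ↦ h.metric y (X y) (X y)) q (Y q) := by
    filter_upwards [hs] with q hq
    have h2 := mvfderiv_metric_self hD.metric p u (Complex.I • u) hq
    rw [h2]
    change _ = (1 / 2) * (2 * h.metric q (D X q (Y q)) (X q))
    rw [hBC q hq]
    ring
  have h1 := hD.metric (X := X) hA (hd u hp)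
  rw [mvfderiv_congr hAX, mvfderiv_const_mul (hsmooth u)] at h1
  have h2 := hD.metric (X := Y) hB (hd u hp)
  rw [mvfderiv_congr hBX, mvfderiv_const_mul (hsmooth _)] at h2
  have h3 : curvatureAt D p u (J p u) (J p u) = D A p (X p) - D B p (Y p) := by
    have h4 : VectorField.mlieBracket 𝓘(ℝ, E) X Y p = 0 := mlieBracket_coordField p _ _ hp
    have h5 : curvatureAt D p u (J p u) (J p u) = D A p (X p) - D B p (Y p)
      - D Y p (VectorField.mlieBracket 𝓘(ℝ, E) X Y p) := rfl
    rw [h5, h4, map_zero, sub_zero]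
  have h6 : h.metric p (curvatureAt D p u (J p u) (J p u)) (X p) =
      h.metric p (D A p (X p)) (X p) - h.metric p (D B p (Y p)) (X p) := by
    rw [h3, h.metric_sub]
  have h7 : D X p (Y p) = B p := hBC p hp
  change _ = h.metric p (D A p (X p)) (X p) + h.metric p (A p) (D X p (X p)) at h1
  change _ = h.metric p (D B p (Y p)) (X p) + h.metric p (B p) (D X p (Y p)) at h2
  change -1 / 2 * h.secondDeriv p u u = _ at h1
  change 1 / 2 * h.secondDeriv p (Complex.I • u) u = _ at h2
  rw [h7] at h2
  have hAp : A p = D Y p (Y p) := rfl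
  have hBp : B p = D Y p (X p) := rfl
  rw [hAp] at h1
  rw [hBp] at h2
  rw [hXp] at h1 h6
  rw [hXp] at h2
  rw [hYp] at h1 h2 h6
  rw [h6]
  linarith

/-- The curvature in the holomorphic direction `u` of the Chern connection. The second derivatives
of the metric are the same as in `IsLeviCivita.metric_curvatureAt`, so that only first order terms
remain in the difference. -/
theorem IsChern.metric_curvatureAt (hD : IsChern h D) (p : M) (u : E) :
    h.metric p (curvatureAt D p (J p u) u u) (J p u) =
      -(h.secondDeriv p u u + h.secondDeriv p (Complex.I • u) u) / 2
      + 2 * h.metric p (D (coordField p u) p u) (D (coordField p u) p u) := by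
  have hp := mem_chart_source E p
  have hs := (chartAt E p).open_source.mem_nhds hp
  set X : VField E M := coordField p u
  set Y : VField E M := coordField p (Complex.I • u)
  have hd := fun x {q} (hq : q ∈ (chartAt E p).source) ↦ isDifferentiableAt_coordField p x hq
  have hXp : X p = u := coordField_self p u
  have hYp : Y p = J p u := coordField_self p _
  let Z : VField E M := fun q ↦ D X q (X q)
  let W : VField E M := fun q ↦ D X q (Y q)
  have hZ : IsDifferentiableAt Z p := hD.isDifferentiableAt_apply_coordField p _ _
  have hW : IsDifferentiableAt W p := hD.isDifferentiableAt_apply_coordField p _ _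
  have hJ : ∀ q ∈ (chartAt E p).source, Y q = J q (X q) :=
    fun q hq ↦ (J_coordField p u hq).symm
  have hWZ : ∀ q ∈ (chartAt E p).source, W q = J q (Z q) := fun q hq ↦ by
    simp only [W, Z]
    rw [hJ q hq, hD.apply_J_coordField p u hq]
  have hDW : D W p (X p) = J p (D Z p (X p)) := by
    have h1 : W =ᶠ[nhds p] fun q ↦ J q (Z q) := by filter_upwards [hs] with q hq using hWZ q hq
    rw [congr_of_eventuallyEq D hW hZ.J h1]
    exact hD.complex hZ
  have hsmooth (x : E) := mdifferentiableAt_mvfderiv_metric h p x u u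
  have hZX : (fun q ↦ h.metric q (Z q) (X q)) =ᶠ[nhds p] fun q ↦ (1 / 2) *
      mvfderiv 𝓘(ℝ, E) (fun y ↦ h.metric y (X y) (X y)) q (X q) := by
    filter_upwards [hs] with q hq
    have h1 : mvfderiv 𝓘(ℝ, E) (fun y ↦ h.metric y (X y) (X y)) q (X q) =
      2 * h.metric q (Z q) (X q) := mvfderiv_metric_self hD.metric_re p u u hq
    rw [h1]
    ring
  -- `g(Z, JX) = -g(JZ, X) = -g(D_Y X, X)`
  have hZY : (fun q ↦ h.metric q (Z q) (Y q)) =ᶠ[nhds p] fun q ↦ (-1 / 2) *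
      mvfderiv 𝓘(ℝ, E) (fun y ↦ h.metric y (X y) (X y)) q (Y q) := by
    filter_upwards [hs] with q hq
    have h1 : mvfderiv 𝓘(ℝ, E) (fun y ↦ h.metric y (X y) (X y)) q (Y q) =
      2 * h.metric q (W q) (X q) := mvfderiv_metric_self hD.metric_re p u (Complex.I • u) hq
    rw [h1, hWZ q hq, hJ q hq, h.metric_J_left]
    ring
  have h1 := hD.metric_re (X := X) hZ (hd u hp)
  rw [mvfderiv_congr hZX, mvfderiv_const_mul (hsmooth u)] at h1
  have h2 := hD.metric_re (X := Y) hZ (hd (Complex.I • u) hp)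
  rw [mvfderiv_congr hZY, mvfderiv_const_mul (hsmooth _)] at h2
  have h3 : curvatureAt D p (J p u) u u = D Z p (Y p) - D W p (X p) := by
    have h4 : VectorField.mlieBracket 𝓘(ℝ, E) Y X p = 0 := mlieBracket_coordField p _ _ hp
    have h5 : curvatureAt D p (J p u) u u = D Z p (Y p) - D W p (X p)
      - D X p (VectorField.mlieBracket 𝓘(ℝ, E) Y X p) := rfl
    rw [h5, h4, map_zero, sub_zero]
  have h7 : D Y p (Y p) = -Z p := by
    rw [hJ p hp, hD.apply_coordField_I_smul p u hp, hD.apply_J_coordField p u hp, J_J]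
  change 1 / 2 * h.secondDeriv p u u =
    h.metric p (D Z p (X p)) (X p) + h.metric p (Z p) (Z p) at h1
  change -1 / 2 * h.secondDeriv p (Complex.I • u) u =
    h.metric p (D Z p (Y p)) (Y p) + h.metric p (Z p) (D Y p (Y p)) at h2
  rw [h7, h.metric_neg'] at h2
  have h8 : h.metric p (curvatureAt D p (J p u) u u) (Y p) =
      h.metric p (D Z p (Y p)) (Y p) - h.metric p (D Z p (X p)) (X p) := by
    rw [h3, h.metric_sub, hDW, hJ p hp, h.metric_J_J]
  have hZp : Z p = D X p (X p) := rfl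
  rw [hZp] at h1 h2
  rw [hXp] at h1 h2 h8
  rw [hYp] at h2 h8
  rw [h8]
  linarith

end HolomorphicSectionalCurvature

/-! ### Vanishing of the Chern torsion -/

section Torsion

variable {E : Type*} [NormedAddCommGroup E] [NormedSpace ℂ E] [FiniteDimensional ℂ E]
  {M : Type*} [TopologicalSpace M] [ChartedSpace E M] [IsManifold 𝓘(ℂ, E) ω M]
  {h : HermitianMetric E M} {D D' : AffineConnection E M}

theorem torsion_eq_coordField (D : AffineConnection E M) (p : M) (u v : TangentSpace 𝓘(ℝ, E) p) :
    D.torsion p u v = D (coordField p v) p u - D (coordField p u) p v := by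
  have hp := mem_chart_source E p
  have h1 := D.torsion_apply (isDifferentiableAt_coordField (E := E) p u hp)
    (isDifferentiableAt_coordField (E := E) p v hp)
  rw [mlieBracket_coordField (E := E) p u v hp, sub_zero] at h1
  have hu : coordField (E := E) p u p = u := coordField_self p _
  have hv : coordField (E := E) p v p = v := coordField_self p _
  rwa [hu, hv] at h1

/-- The torsion of the Chern connection is complex linear in the first variable, that is, it has no
`(1,1)` part. -/
theorem IsChern.torsion_J (hD : IsChern h D) (p : M) (u v : TangentSpace 𝓘(ℝ, E) p) :
    D.torsion p (J p u) v = J p (D.torsion p u v) := by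
  have hp := mem_chart_source E p
  have h1 : D (coordField p (J p u)) p v = J p (D (coordField p u) p v) :=
    hD.apply_coordField_I_smul p u hp v
  have h2 : D (coordField p v) p (J p u) = J p (D (coordField p v) p u) :=
    hD.apply_J_coordField p v hp u
  rw [torsion_eq_coordField D p u v, map_sub, ← h1, ← h2]
  exact torsion_eq_coordField D p (J p u) v

theorem IsChern.torsion_J_right (hD : IsChern h D) (p : M) (u v : TangentSpace 𝓘(ℝ, E) p) :
    D.torsion p u (J p v) = J p (D.torsion p u v) := by
  rw [D.torsion_antisymm, hD.torsion_J, D.torsion_antisymm v u, map_neg]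
  exact neg_neg _

/-- `2 g(∇_u v - D'_u v, w)` is a combination of components of the torsion of the Chern
connection (denoted `D'` below, while `∇` is denoted `D`). -/
theorem two_mul_metric_leviCivita (hD : IsLeviCivita h D) (hD' : IsChern h D') (p : M)
    (u v w : TangentSpace 𝓘(ℝ, E) p) :
    2 * h.metric p (D (coordField p v) p u) w =
      2 * h.metric p (D' (coordField p v) p u) w - h.metric p (D'.torsion p u v) w
        + h.metric p v (D'.torsion p u w) + h.metric p u (D'.torsion p v w) := by
  have hp := mem_chart_source E p
  have hd := fun x : E ↦ isDifferentiableAt_coordField p x hp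
  have hself (x : TangentSpace 𝓘(ℝ, E) p) : coordField (E := E) p x p = x := coordField_self p _
  have h1 := hD.koszul p u v w hp
  rw [hD'.metric_re (hd v) (hd w), hD'.metric_re (hd u) (hd w), hD'.metric_re (hd u) (hd v),
    hself u, hself v, hself w] at h1
  rw [torsion_eq_coordField D' p u v, torsion_eq_coordField D' p u w,
    torsion_eq_coordField D' p v w, h.metric_sub, h.metric_sub', h.metric_sub', h1,
    h.metric_symm p (D' (coordField p u) p w) v]
  ring

/-- If the Levi-Civita connection `D` and the Chern connection `D'` have the same curvature in the
holomorphic direction `u`, then the Chern torsion `T(u, ·)` is orthogonal to `u`: the difference of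
the two curvatures is the squared norm of the linear form `g(u, T(u, ·))`. -/
theorem metric_torsion_eq_zero (hD : IsLeviCivita h D) (hD' : IsChern h D') (p : M)
    (u : TangentSpace 𝓘(ℝ, E) p)
    (hu : h.metric p (curvatureAt D p u (J p u) (J p u)) u =
      h.metric p (curvatureAt D' p (J p u) u u) (J p u)) (w : TangentSpace 𝓘(ℝ, E) p) :
    h.metric p u (D'.torsion p u w) = 0 := by
  have hp := mem_chart_source E p
  have h1 := hD.metric_curvatureAt p u
  rw [hu, hD'.metric_curvatureAt p u] at h1
  change _ = _ + h.metric p (D (coordField p (J p u)) p u) (D (coordField p (J p u)) p u)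
    - h.metric p (D (coordField p (J p u)) p (J p u)) (D (coordField p u) p u) at h1
  set Z := D' (coordField p u) p u
  have hZ1 : D' (coordField p (J p u)) p u = J p Z := hD'.apply_coordField_I_smul p u hp u
  have hZ2 : D' (coordField p (J p u)) p (J p u) = -Z := by
    refine (hD'.apply_J_coordField p _ hp u).trans ?_
    rw [hZ1, J_J]
  have hT : D'.torsion p u u = 0 := D'.torsion_self u
  have hT' : D'.torsion p u (J p u) = 0 := by rw [hD'.torsion_J_right, hT, map_zero]
  have hTJ : D'.torsion p (J p u) (J p u) = 0 := D'.torsion_self _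
  have e1 : D (coordField p (J p u)) p u = J p Z := by
    refine h.eq_of_metric_eq fun w ↦ ?_
    have h2 := two_mul_metric_leviCivita hD hD' p u (J p u) w
    rw [hZ1, hT', h.metric_zero, hD'.torsion_J, h.metric_J_left p u] at h2
    linarith
  have e2 (w : TangentSpace 𝓘(ℝ, E) p) : h.metric p (D (coordField p u) p u) w =
      h.metric p Z w + h.metric p u (D'.torsion p u w) := by
    have h2 := two_mul_metric_leviCivita hD hD' p u u w
    rw [hT, h.metric_zero] at h2
    linarith
  have e3 (w : TangentSpace 𝓘(ℝ, E) p) : h.metric p (D (coordField p (J p u)) p (J p u)) w =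
      -h.metric p Z w + h.metric p u (D'.torsion p u w) := by
    have h2 := two_mul_metric_leviCivita hD hD' p (J p u) (J p u) w
    rw [hTJ, h.metric_zero, hD'.torsion_J, h.metric_J_J, hZ2, h.metric_neg] at h2
    linarith
  -- `t` represents the linear form `g(u, T(u, ·))`
  set t := D (coordField p u) p u - Z with ht
  have e4 (w : TangentSpace 𝓘(ℝ, E) p) : h.metric p t w = h.metric p u (D'.torsion p u w) := by
    rw [ht, h.metric_sub, e2]
    ring
  have e5 : D (coordField p u) p u = Z + t := by rw [ht]; abel
  have e6 : D (coordField p (J p u)) p (J p u) = t - Z := by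
    refine h.eq_of_metric_eq fun w ↦ ?_
    rw [e3, h.metric_sub, e4]
    ring
  rw [e1, e5, e6, h.metric_J_J, h.metric_sub, h.metric_add', h.metric_add',
    h.metric_symm p t Z] at h1
  have h2 : h.metric p t t = 0 := by linarith
  have h3 : t = 0 := by
    by_contra hne
    exact (h.pos p t hne).ne' h2
  rw [← e4, h3, h.metric_zero]

/-- A Chern torsion `T` with `g(u, T(u, ·)) = 0` for all `u` vanishes. -/
theorem IsChern.torsion_eq_zero (hD : IsChern h D) (p : M)
    (hT : ∀ u w, h.metric p u (D.torsion p u w) = 0) : D.torsion p = 0 := by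
  -- polarization of the hypothesis
  have h1 (u v w : TangentSpace 𝓘(ℝ, E) p) :
      h.metric p u (D.torsion p v w) = -h.metric p v (D.torsion p u w) := by
    have h2 := hT (u + v) w
    rw [torsion_add₁, h.metric_add, h.metric_add', h.metric_add', hT, hT] at h2
    linarith
  -- `T` is complex bilinear, while `g(u, T(v, w))` is skew in `u` and `v`
  have h4 (u v w : TangentSpace 𝓘(ℝ, E) p) : h.metric p u (J p (D.torsion p v w)) = 0 := by
    have h2 := h1 (J p u) v w
    have h3 := h1 u v (J p w)
    rw [hD.torsion_J, h.metric_J_left] at h2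
    rw [hD.torsion_J_right, hD.torsion_J_right] at h3
    linarith
  ext v w : 2
  refine h.eq_of_metric_eq fun u ↦ ?_
  change _ = h.metric p 0 u
  rw [h.metric_zero, h.metric_symm, ← h.metric_J_J, h4]

/-- The differential of the fundamental form in terms of the torsion of the Chern connection. -/
theorem IsChern.dFundamentalForm_eq (hD : IsChern h D) {X Y Z : VField E M} {p : M}
    (hX : IsDifferentiableAt X p) (hY : IsDifferentiableAt Y p) (hZ : IsDifferentiableAt Z p) :
    h.dFundamentalForm X Y Z p = h.fundamentalForm p (D.torsion p (X p) (Y p)) (Z p)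
      - h.fundamentalForm p (D.torsion p (X p) (Z p)) (Y p)
      + h.fundamentalForm p (D.torsion p (Y p) (Z p)) (X p) := by
  have key {X σ τ : VField E M} (hσ : IsDifferentiableAt σ p) (hτ : IsDifferentiableAt τ p) :
      mvfderiv 𝓘(ℝ, E) (fun q ↦ h.fundamentalForm q (σ q) (τ q)) p (X p) =
        h.fundamentalForm p (D σ p (X p)) (τ p) - h.fundamentalForm p (D τ p (X p)) (σ p) := by
    have h1 := hD.metric_re (X := X) hσ.J hτ
    rw [hD.complex hσ, h.metric_J_left p (σ p), h.metric_symm p (σ p)] at h1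
    exact h1.trans (sub_eq_add_neg _ _).symm
  have hsub (u v w : TangentSpace 𝓘(ℝ, E) p) : h.fundamentalForm p (u - v) w =
      h.fundamentalForm p u w - h.fundamentalForm p v w := by
    simp only [HermitianMetric.fundamentalForm]
    rw [map_sub, h.metric_sub]
  rw [HermitianMetric.dFundamentalForm, key hY hZ, key hX hZ, key hX hY,
    D.torsion_apply hX hY, D.torsion_apply hX hZ, D.torsion_apply hY hZ]
  simp only [hsub]
  ring

end Torsion

theorem metric_curvatureAt_eq_of_sectional {E : Type*} [NormedAddCommGroup E] [NormedSpace ℂ E]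
    [FiniteDimensional ℂ E] {M : Type*} [TopologicalSpace M] [ChartedSpace E M]
    [IsManifold 𝓘(ℂ, E) ω M] (h : HermitianMetric E M) (p : M) {u : TangentSpace 𝓘(ℝ, E) p}
    (hu : u ≠ 0)
    (hK : h.riemannSectionalCurvature p u (J p u) = h.chernSectionalCurvature p u (J p u)) :
    h.metric p (curvatureAt h.leviCivita p u (J p u) (J p u)) u =
      h.metric p (curvatureAt h.chern p (J p u) u u) (J p u) := by
  have h1 : h.metric p u u * h.metric p (J p u) (J p u) - h.metric p u (J p u) ^ 2 ≠ 0 := by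
    have h2 : 0 < h.metric p u u := h.pos p u hu
    rw [h.metric_J_J, h.metric_J_self, zero_pow two_ne_zero, sub_zero]
    exact (mul_pos h2 h2).ne'
  exact (div_left_inj' h1).1 hK

theorem linearIndependent_J {E : Type*} [NormedAddCommGroup E] [NormedSpace ℂ E]
    {M : Type*} [TopologicalSpace M] [ChartedSpace E M] (p : M) {u : TangentSpace 𝓘(ℝ, E) p}
    (hu : u ≠ 0) : LinearIndependent ℝ ![u, J p u] := by
  rw [LinearIndependent.pair_iff]
  intro s t hst
  let x : E := u
  have h1 : ((s : ℂ) + t * Complex.I) • x = 0 := by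
    rw [add_smul, mul_smul]
    exact hst
  have h2 := (smul_eq_zero.1 h1).resolve_right hu
  exact ⟨by simpa using congrArg Complex.re h2, by simpa using congrArg Complex.im h2⟩

end HermitianGeometry

end

theorem corollary1p2 {E : Type*} [NormedAddCommGroup E] [NormedSpace ℂ E] [FiniteDimensional ℂ E]
    {M : Type*} [TopologicalSpace M] [ChartedSpace E M] [IsManifold 𝓘(ℂ, E) ω M]
    (h : HermitianGeometry.HermitianMetric E M)
    (hK : ∀ (p : M) (u v : TangentSpace 𝓘(ℝ, E) p), LinearIndependent ℝ ![u, v] →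
      h.riemannSectionalCurvature p u v = h.chernSectionalCurvature p u v) :
    h.IsKahler := by
  intro p X Y Z hX hY hZ
  have hT : h.chern.torsion p = 0 := by
    refine h.isChern.torsion_eq_zero p fun u w ↦ ?_
    rcases eq_or_ne u 0 with rfl | hu
    · rw [h.metric_zero]
    · exact HermitianGeometry.metric_torsion_eq_zero h.isLeviCivita h.isChern p u
        (HermitianGeometry.metric_curvatureAt_eq_of_sectional h p hu
          (hK p u _ (HermitianGeometry.linearIndependent_J p hu))) w
  rw [h.isChern.dFundamentalForm_eq hX hY hZ, hT]
  simp [HermitianGeometry.HermitianMetric.fundamentalForm, h.metric_zero]
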